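/- **Setting.** Let $(M,g)$ be a $(1+d)$-dimensional globally hyperbolic space-time of signature $(1,-1,\dots,-1)$ with volume measure $dy$: $M\cong\mathbb R\times\Sigma$ as a smooth manifold, the time coordinate $t$ satisfies $dt(v)\ne 0$ for every causal $v\neq0$ (the future directed causal vectors are those with $dt(v)>0$), and the causal hull $J^+(K)\cap J^-(K)$ of every compact $K$ is compact. Write $\mathcal D=C_0^\infty(M,\mathbb C)$ and let $m,b>0$, $b_n\in\mathbb R$ $(n\ge3)$. Elements of $\mathcal D(M^n,\mathbb C)'$ are described by their values on product test functions, i.e. as $n$-linear functionals on $\mathcal D$ that are (sequentially) jointly continuous. Let $G_{\rm r},G_{\rm a}$ be the retarded and advanced fundamental solutions of $\Box+m^2$: real distributions with smooth kernel functions $G_{\rm r/a}(f,\cdot)$, $G_{\rm r/a}(f,h)=\int G_{\rm r/a}(f,y)h(y)\,dy$, such that $G_{\rm r/a}((\Box+m^2)f,h)=G_{\rm r/a}(f,(\Box+m^2)h)=\int fh\,dy$ and ${\rm supp}\,G_{\rm r/a}(f,\cdot)\subseteq J^{\mp}({\rm supp} f)$. Let $D=G_{\rm r}-G_{\rm a}$.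 Let $D^+\in\mathcal D(M\times M,\mathbb C)'$ be given by measurable, locally integrable kernel functions $D^+(f,\cdot)$ depending linearly on $f\in\mathcal D$, $D^+(f,h)=\int D^+(f,y)h(y)\,dy$, such that ${\rm Im}\,D^+=D$, $D^+((\Box+m^2)f,h)=D^+(f,(\Box+m^2)h)=0$, $D^+(h,f)=\overline{D^+(\bar f,\bar h)}$, $D^+(\bar f,f)\ge0$, and $D^+$ is invariant under the isometric diffeomorphisms preserving the time direction. Put $D^-(f,y)=\overline{D^+(\bar f,y)}$. **Dispersion condition.** For every $n\ge3$ with $b_n\ne0$: (i) $\int_M|D^+(f,x)|^n\,dx<\infty$ for all $f\in\mathcal D$; (ii) if $f_j\to0$ in $\mathcal D$, then $D^+(f_j,x)\to0$ for all $x\in M$, and there is a measurable $F:M\to\mathbb R$ with $|D^+(f_j,x)|\le F(x)$ for all $j,x$ and $\int_M F(x)|D^+(f,x)|^{n-1}dx<\infty$ for all $f\in\mathcal D$. **Ansatz.** The unknowns are the truncated functions $\langle\phi^{a_1}(f_1)\cdots\phi^{a_n}(f_n)\rangle^T$, $a_i\in\{{\rm in},{\rm loc}\}$, $f_i\in\mathcal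 D$, where $\phi^{\rm loc}=\phi$ (the truncated function of the empty word being $0$), and the Wightman functions, which are the sums over all partitions of $\{1,\dots,n\}$ of the products of the truncated functions of the blocks. With $j(f)=\phi((\Box+m^2)f)$ for $f\in\mathcal D$ one demands: * $\langle\phi(f)\rangle^T=0$ and $\langle\phi(f)\phi(h)\rangle^T=\frac{b^2}{m^2}D^+(f,h)$; * for $n\ge3$, $\langle\phi(f_1)\cdots j(f_k)\cdots\phi(f_n)\rangle^T=b_n\int_M\prod_{l<k}D^-(f_l,y)\,f_k(y)\prod_{l>k}D^+(f_l,y)\,dy$; * truncated functions of local fields and currents that contain two or more currents $j$ vanish; * the in-field is quasi-free: $\langle\phi^{\rm in}(f)\phi^{\rm in}(h)\rangle^T=\frac{b^2}{m^2}D^+(f,h)$ and $\langle\phi^{\rm in}(f_1)\cdots\phi^{\rm in}(f_n)\rangle^T=0$ for $n\neq2$; * the Yang–Feldman condition: $\langle\cdots\phi(f_k)\cdots\rangle^T=\langle\cdots\phi^{\rm in}(f_k)\cdots\rangle^T+\langle\cdots j(G_{\rm r}f_k)\cdots\rangle^T$, with arbitrary in- or local fields in the other places, where $G_{\rm r}f_k=G_{\rm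 r}(f_k,\cdot)$ and $j(G_{\rm r}f_k)$ stands for the limit of $j(\chi_NG_{\rm r}f_k)$ as $N\to\infty$, which has to exist and satisfy the equation for every sequence $\chi_N\in\mathcal D$ with values in $[0,1]$ such that every compact set is eventually contained in $\{\chi_N=1\}$. **Theorem 3.1.** This system has exactly one solution. Its two-point functions are $\langle\phi^{a_1}(f)\phi^{a_2}(h)\rangle^T=\frac{b^2}{m^2}D^+(f,h)$ for all $a_1,a_2\in\{{\rm in},{\rm loc}\}$, and for $n\ge3$ $$\langle\phi(f_1)\cdots\phi(f_n)\rangle^T=b_n\sum_{k=1}^n\int_M\prod_{l=1}^{k-1}D^-(f_l,y)\;G_{\rm r}(f_k,y)\prod_{l=k+1}^nD^+(f_l,y)\,dy ,$$ where the integrals converge absolutely for every $n\ge 3$ for which (i) and (ii) hold. All truncated functions of the solution are distributions. -/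

import Mathlib

set_option linter.unusedSectionVars false
open Set Filter Topology MeasureTheory
open scoped Manifold ContDiff ComplexConjugate

noncomputable section

namespace CurvedQFT

/-- The coordinate space `ℝ^{1+d}` of a space-time of dimension `1 + d`. -/
abbrev Coord (d : ℕ) : Type := EuclideanSpace ℝ (Fin (d + 1))

/-- The `i`-th coordinate vector. -/
abbrev basisVec {d : ℕ} (i : Fin (d + 1)) : Coord d := EuclideanSpace.single i (1 : ℝ)

section Metric

variable {d : ℕ} {M : Type*} [TopologicalSpace M] [ChartedSpace (Coord d) M]

/-- The matrix `g_{ij}` at the coordinate point `u` of a field of bilinear forms on the tangent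
spaces, in the chart around `p`. -/
def metricCoord
    (g : ∀ x : M, LinearMap.BilinForm ℝ (TangentSpace 𝓘(ℝ, Coord d) x))
    (p : M) (u : Coord d) : Matrix (Fin (d + 1)) (Fin (d + 1)) ℝ :=
  Matrix.of fun i j =>
    g ((chartAt (Coord d) p).symm u)
      (mfderiv 𝓘(ℝ, Coord d) 𝓘(ℝ, Coord d) (chartAt (Coord d) p).symm u (basisVec i))
      (mfderiv 𝓘(ℝ, Coord d) 𝓘(ℝ, Coord d) (chartAt (Coord d) p).symm u (basisVec j))

/-- The matrix `diag (1, -1, …, -1)`. -/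
def minkowskiEntry {d : ℕ} (i j : Fin (d + 1)) : ℝ :=
  if i = j then (if i = 0 then 1 else -1) else 0

end Metric

/-- A smooth Lorentzian metric of signature `(1, -1, …, -1)`. -/
structure LorentzianMetric (d : ℕ) (M : Type*) [TopologicalSpace M]
    [ChartedSpace (Coord d) M] where
  /-- the bilinear form on the tangent space at a point -/
  form : ∀ x : M, LinearMap.BilinForm ℝ (TangentSpace 𝓘(ℝ, Coord d) x)
  signature : ∀ x : M, ∃ e : Module.Basis (Fin (d + 1)) ℝ (TangentSpace 𝓘(ℝ, Coord d) x),
    ∀ i j, form x (e i) (e j) = minkowskiEntry i j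
  smooth : ∀ (p : M) (i j : Fin (d + 1)),
    ContDiffOn ℝ ∞ (fun u => metricCoord form p u i j) (chartAt (Coord d) p).target

namespace LorentzianMetric

variable {d : ℕ} {M : Type*} [TopologicalSpace M] [ChartedSpace (Coord d) M]

/-- The density `√|det (g_{ij})|` in the chart around `p`. -/
def density (g : LorentzianMetric d M) (p : M) (u : Coord d) : ℝ :=
  Real.sqrt |(metricCoord g.form p u).det|

/-- The canonical volume measure: the least measure that on the domain of each chart dominates
(equivalently, is equal to) `√|det (g_{ij})| du`. -/
def volumeMeasure [MeasurableSpace M] (g : LorentzianMetric d M) : Measure M :=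
  ⨆ p : M, (((volume : Measure (Coord d)).restrict (chartAt (Coord d) p).target).withDensity
    (fun u => ENNReal.ofReal (g.density p u))).map (chartAt (Coord d) p).symm

/-- The coordinate expression `|det g|^{-1/2} ∑ᵢ ∂ᵢ (|det g|^{1/2} ∑ⱼ g^{ij} ∂ⱼ f)` of the
d'Alembertian in the chart around `p`, at the coordinate point `u`. -/
def boxChart (g : LorentzianMetric d M) (p : M) (f : M → ℂ) (u : Coord d) : ℂ :=
  (g.density p u)⁻¹ • ∑ i, fderiv ℝ (fun w => g.density p w •
    ∑ j, (metricCoord g.form p w)⁻¹ i j •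
      fderiv ℝ (f ∘ (chartAt (Coord d) p).symm) w (basisVec j)) u (basisVec i)

/-- The d'Alembertian `□ f`. -/
def box (g : LorentzianMetric d M) (f : M → ℂ) (x : M) : ℂ :=
  g.boxChart x f (chartAt (Coord d) x x)

end LorentzianMetric
section Calculus

theorem two_le_infty : (2 : ℕ∞ω) ≤ ∞ := by
  exact WithTop.coe_le_coe.2 (le_top : (2 : ℕ∞) ≤ ⊤)

variable {d : ℕ}

/-- Jacobi's formula. -/
theorem hasFDerivAt_det {ι : Type*} [Fintype ι] [DecidableEq ι] {E : Type*}
    [NormedAddCommGroup E] [NormedSpace ℝ E]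
    {A : E → Matrix ι ι ℝ} {A' : ι → ι → E →L[ℝ] ℝ} {u : E}
    (hA : ∀ i j, HasFDerivAt (fun w => A w i j) (A' i j) u) :
    HasFDerivAt (fun w => (A w).det) (∑ i, ∑ j, (A u).adjugate i j • A' j i) u := by
  have h1 : HasFDerivAt (fun w => (A w).det)
      (∑ σ : Equiv.Perm ι, ((Equiv.Perm.sign σ : ℤ) : ℝ) •
        ∑ i, (∏ j ∈ Finset.univ.erase i, A u (σ j) j) • A' (σ i) i) u := by
    simp only [Matrix.det_apply']
    refine HasFDerivAt.fun_sum fun σ _ => ?_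
    refine HasFDerivAt.const_mul ?_ _
    exact HasFDerivAt.finsetProd fun i _ => hA (σ i) i
  convert h1 using 1
  ext v
  simp only [_root_.sum_apply, _root_.smul_apply, smul_eq_mul,
    Finset.mul_sum]
  rw [Finset.sum_comm (s := (Finset.univ : Finset (Equiv.Perm ι)))]
  refine Finset.sum_congr rfl fun i _ => ?_
  have h2 : ∑ j, (A u).adjugate i j * A' j i v
      = ((A u).updateCol i (fun j => A' j i v)).det := by
    rw [← Matrix.cramer_apply, Matrix.cramer_eq_adjugate_mulVec]
    rfl
  rw [h2, Matrix.det_apply']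
  refine Finset.sum_congr rfl fun σ _ => ?_
  congr 1
  rw [← Finset.mul_prod_erase _ _ (Finset.mem_univ i), mul_comm]
  congr 1
  · refine Finset.prod_congr rfl fun j hj => ?_
    rw [Matrix.updateCol_ne (Finset.ne_of_mem_erase hj)]
  · simp

/-- The Jacobi matrix of a map of the coordinate space. -/
def jacobiMatrix (τ : Coord d → Coord d) (u : Coord d) :
    Matrix (Fin (d + 1)) (Fin (d + 1)) ℝ :=
  Matrix.of fun k i => (fderiv ℝ τ u (basisVec i)) k

theorem jacobiMatrix_hasFDerivAt {τ : Coord d → Coord d} {u : Coord d}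
    (hτ : ContDiffAt ℝ ∞ τ u) (k i : Fin (d + 1)) :
    HasFDerivAt (fun w => jacobiMatrix τ w k i)
      ((EuclideanSpace.proj k : Coord d →L[ℝ] ℝ).comp
        ((fderiv ℝ (fderiv ℝ τ) u).flip (basisVec i))) u := by
  have h1 : DifferentiableAt ℝ (fderiv ℝ τ) u :=
    (hτ.fderiv_right (m := 1) (by rw [one_add_one_eq_two]; exact two_le_infty)).differentiableAt (by simp)
  have h2 : HasFDerivAt (fun w => fderiv ℝ τ w (basisVec i))
      ((fderiv ℝ (fderiv ℝ τ) u).flip (basisVec i)) u := by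
    simpa using h1.hasFDerivAt.clm_apply (hasFDerivAt_const (basisVec i : Coord d) u)
  exact (EuclideanSpace.proj k : Coord d →L[ℝ] ℝ).hasFDerivAt.comp u h2

/-- The columns of the cofactor matrix of a Jacobi matrix are divergence free. -/
theorem piola {τ : Coord d → Coord d} {u : Coord d}
    (hτ : ContDiffAt ℝ ∞ τ u) (hdet : (jacobiMatrix τ u).det ≠ 0) :
    ∃ C : Fin (d + 1) → Fin (d + 1) → Coord d →L[ℝ] ℝ,
      (∀ i k, HasFDerivAt (fun w => (jacobiMatrix τ w).adjugate i k) (C i k) u) ∧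
      ∀ k, ∑ i, C i k (basisVec i) = 0 := by
  set A := jacobiMatrix τ with hA
  set A' : Fin (d + 1) → Fin (d + 1) → Coord d →L[ℝ] ℝ := fun k i =>
    ((EuclideanSpace.proj k : Coord d →L[ℝ] ℝ).comp
        ((fderiv ℝ (fderiv ℝ τ) u).flip (basisVec i))) with hA'
  have hAd : ∀ k i, HasFDerivAt (fun w => A w k i) (A' k i) u :=
    fun k i => jacobiMatrix_hasFDerivAt hτ k i
  have hsymm : ∀ k i j, A' k i (basisVec j) = A' k j (basisVec i) := by
    intro k i j
    have := (hτ.isSymmSndFDerivAt (by simpa using two_le_infty)).eq (basisVec i) (basisVec j)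
    simp only [hA', ContinuousLinearMap.comp_apply, ContinuousLinearMap.flip_apply, this]
  -- differentiability of the adjugate
  have hadj : ∀ i k, DifferentiableAt ℝ (fun w => (A w).adjugate i k) u := by
    intro i k
    simp only [Matrix.adjugate_apply]
    refine (hasFDerivAt_det (A' := fun a b => if a = k then 0 else A' a b)
      (fun a b => ?_)).differentiableAt
    by_cases h : a = k
    · subst h
      simpa using hasFDerivAt_const _ _
    · simpa [h, Matrix.updateRow_ne h] using hAd a b
  refine ⟨fun i k => fderiv ℝ (fun w => (A w).adjugate i k) u,
    fun i k => (hadj i k).hasFDerivAt, fun k => ?_⟩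
  set C := fun i k => fderiv ℝ (fun w => (A w).adjugate i k) u with hC
  have hD := hasFDerivAt_det hAd
  set D' : Coord d →L[ℝ] ℝ := ∑ i, ∑ j, (A u).adjugate i j • A' j i with hD'
  -- differentiate `adj A * A = det A • 1`
  have hrel : ∀ (i l : Fin (d + 1)) (v : Coord d),
      ∑ m, (C i m v * A u m l + (A u).adjugate i m * A' m l v)
        = if i = l then D' v else 0 := by
    intro i l v
    have e1 : (fun w => ∑ m, (A w).adjugate i m * A w m l)
        = fun w => if i = l then (A w).det else 0 := by
      funext w
      have := congrFun (congrFun (Matrix.adjugate_mul (A w)) i) l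
      rw [Matrix.mul_apply] at this
      rw [this]
      simp [Matrix.one_apply]
    have d1 : HasFDerivAt (fun w => ∑ m, (A w).adjugate i m * A w m l)
        (∑ m, ((A u).adjugate i m • A' m l + A u m l • C i m)) u :=
      HasFDerivAt.fun_sum fun m _ => (hadj i m).hasFDerivAt.mul (hAd m l)
    have d2 : HasFDerivAt (fun w => ∑ m, (A w).adjugate i m * A w m l)
        (if i = l then D' else 0) u := by
      rw [e1]
      split_ifs
      · exact hD
      · exact hasFDerivAt_const _ _
    have := congrArg (fun L : Coord d →L[ℝ] ℝ => L v) (d1.unique d2)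
    simp only [_root_.sum_apply, _root_.add_apply,
      _root_.smul_apply, smul_eq_mul] at this
    have e3 : (if i = l then D' else 0) v = if i = l then D' v else 0 := by
      split_ifs <;> rfl
    rw [← e3, ← this]
    refine Finset.sum_congr rfl fun m _ => ?_
    ring
  -- contract with `basisVec i` and use the symmetry of second derivatives
  have hz : ∀ l, ∑ m, (∑ i, C i m (basisVec i)) * A u m l = 0 := by
    intro l
    have h1 : ∑ i, ∑ m, (C i m (basisVec i) * A u m l
        + (A u).adjugate i m * A' m l (basisVec i)) = D' (basisVec l) := by
      simp only [hrel]
      simp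
    simp only [Finset.sum_add_distrib] at h1
    have h2 : ∑ i, ∑ m, (A u).adjugate i m * A' m l (basisVec i) = D' (basisVec l) := by
      simp only [hD', _root_.sum_apply, _root_.smul_apply,
        smul_eq_mul]
      refine Finset.sum_congr rfl fun i _ => Finset.sum_congr rfl fun m _ => ?_
      rw [hsymm m l i]
    have h3 : ∑ i, ∑ m, C i m (basisVec i) * A u m l = 0 := by linarith
    rw [Finset.sum_comm] at h3
    simpa only [Finset.sum_mul] using h3
  have hvec : Matrix.vecMul (fun m => ∑ i, C i m (basisVec i)) (A u) = 0 := by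
    funext l
    simpa [Matrix.vecMul, dotProduct] using hz l
  have := Matrix.eq_zero_of_vecMul_eq_zero hdet hvec
  exact congrFun this k

/-- The divergence under a change of coordinates. -/
theorem divergence_comp {τ : Coord d → Coord d} {u : Coord d}
    (hτ : ContDiffAt ℝ ∞ τ u) (hdet : (jacobiMatrix τ u).det ≠ 0)
    {Y : Fin (d + 1) → Coord d → ℂ} (hY : ∀ k, DifferentiableAt ℝ (Y k) (τ u)) :
    ∑ i, fderiv ℝ (fun w => ∑ k, (jacobiMatrix τ w).adjugate i k • Y k (τ w)) u (basisVec i)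
      = (jacobiMatrix τ u).det • ∑ k, fderiv ℝ (Y k) (τ u) (basisVec k) := by
  obtain ⟨C, hC, hC0⟩ := piola hτ hdet
  set A := jacobiMatrix τ with hA
  have hτd : HasFDerivAt τ (fderiv ℝ τ u) u :=
    (hτ.differentiableAt (by simp)).hasFDerivAt
  have hfd : ∀ i, HasFDerivAt (fun w => ∑ k, (A w).adjugate i k • Y k (τ w))
      (∑ k, ((A u).adjugate i k • (fderiv ℝ (Y k) (τ u)).comp (fderiv ℝ τ u)
        + (C i k).smulRight (Y k (τ u)))) u := fun i =>
    HasFDerivAt.fun_sum fun k _ => (hC i k).smul ((hY k).hasFDerivAt.comp u hτd)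
  have hdir : ∀ i, fderiv ℝ τ u (basisVec i) = ∑ m, A u m i • (basisVec m : Coord d) := by
    intro i
    ext k
    simp [hA, jacobiMatrix, Finset.sum_apply, Pi.single_apply]
  simp only [(hfd _).fderiv, _root_.sum_apply, _root_.add_apply, _root_.smul_apply,
    ContinuousLinearMap.comp_apply, ContinuousLinearMap.smulRight_apply,
    Finset.sum_add_distrib, hdir, map_sum, map_smul]
  have h2 : ∑ i, ∑ k, C i k (basisVec i) • Y k (τ u) = 0 := by
    rw [Finset.sum_comm]
    refine Finset.sum_eq_zero fun k _ => ?_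
    rw [← Finset.sum_smul, hC0, zero_smul]
  rw [h2, add_zero, Finset.sum_comm, Finset.smul_sum]
  refine Finset.sum_congr rfl fun k _ => ?_
  have h3 : ∀ m, ∑ i, A u m i * (A u).adjugate i k = if m = k then (A u).det else 0 := by
    intro m
    have := congrFun (congrFun (Matrix.mul_adjugate (A u)) m) k
    rw [Matrix.mul_apply] at this
    rw [this]
    simp [Matrix.one_apply]
  simp only [Finset.smul_sum, smul_smul]
  rw [Finset.sum_comm]
  calc ∑ m, ∑ i, ((A u).adjugate i k * A u m i) • fderiv ℝ (Y k) (τ u) (basisVec m)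
      = ∑ m, (if m = k then (A u).det else 0) • fderiv ℝ (Y k) (τ u) (basisVec m) := by
        refine Finset.sum_congr rfl fun m _ => ?_
        rw [← Finset.sum_smul, ← h3 m]
        congr 1
        exact Finset.sum_congr rfl fun i _ => mul_comm _ _
    _ = (A u).det • fderiv ℝ (Y k) (τ u) (basisVec k) := by
        simp [ite_smul]

theorem fderiv_basisVec (τ : Coord d → Coord d) (u : Coord d) (i : Fin (d + 1)) :
    fderiv ℝ τ u (basisVec i) = ∑ m, jacobiMatrix τ u m i • (basisVec m : Coord d) := by
  ext k
  simp [jacobiMatrix, Finset.sum_apply, Pi.single_apply]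

end Calculus
namespace LorentzianMetric

variable {d : ℕ} {M : Type*} [TopologicalSpace M] [ChartedSpace (Coord d) M]

/-- The coordinate change between two charts. -/
def transition (p q : M) (u : Coord d) : Coord d :=
  chartAt (Coord d) q ((chartAt (Coord d) p).symm u)

section
variable [IsManifold 𝓘(ℝ, Coord d) ∞ M]

theorem symm_mdifferentiableAt (p : M) {u : Coord d} (hu : u ∈ (chartAt (Coord d) p).target) :
    MDifferentiableAt 𝓘(ℝ, Coord d) 𝓘(ℝ, Coord d) (chartAt (Coord d) p).symm u :=
  (((contMDiffOn_chart_symm (I := 𝓘(ℝ, Coord d)) (n := ∞) (x := p)).contMDiffAt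
    ((chartAt (Coord d) p).open_target.mem_nhds hu))).mdifferentiableAt (by simp)

theorem chart_mdifferentiableAt (p : M) {x : M} (hx : x ∈ (chartAt (Coord d) p).source) :
    MDifferentiableAt 𝓘(ℝ, Coord d) 𝓘(ℝ, Coord d) (chartAt (Coord d) p) x :=
  (((contMDiffOn_chart (I := 𝓘(ℝ, Coord d)) (n := ∞) (x := p)).contMDiffAt
    ((chartAt (Coord d) p).open_source.mem_nhds hx))).mdifferentiableAt (by simp)

/-- The derivative of an inverse chart is injective. -/
theorem mfderiv_symm_injective (p : M) {u : Coord d}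
    (hu : u ∈ (chartAt (Coord d) p).target) :
    Function.Injective
      (mfderiv 𝓘(ℝ, Coord d) 𝓘(ℝ, Coord d) (chartAt (Coord d) p).symm u) := by
  have h1 := chart_mdifferentiableAt (d := d) p ((chartAt (Coord d) p).map_target hu)
  have h2 := symm_mdifferentiableAt (d := d) p hu
  have h3 := mfderiv_comp u h1 h2
  have h4 : (chartAt (Coord d) p ∘ (chartAt (Coord d) p).symm) =ᶠ[𝓝 u] id := by
    filter_upwards [(chartAt (Coord d) p).open_target.mem_nhds hu] with w hw
    exact (chartAt (Coord d) p).right_inv hw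
  rw [h4.mfderiv_eq, mfderiv_id] at h3
  intro v w hvw
  have := congrArg (fun L => L v) h3
  have h5 := congrArg (fun L => L w) h3
  simp only [ContinuousLinearMap.comp_apply] at this h5
  rw [hvw] at this
  exact this.trans h5.symm

theorem transition_contDiffAt (p q : M) {u : Coord d}
    (hu : u ∈ (chartAt (Coord d) p).target)
    (hq : (chartAt (Coord d) p).symm u ∈ (chartAt (Coord d) q).source) :
    ContDiffAt ℝ ∞ (transition (d := d) p q) u := by
  rw [← contMDiffAt_iff_contDiffAt]
  have h1 := ((contMDiffOn_chart_symm (I := 𝓘(ℝ, Coord d)) (n := ∞) (x := p)).contMDiffAt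
    ((chartAt (Coord d) p).open_target.mem_nhds hu))
  have h2 := ((contMDiffOn_chart (I := 𝓘(ℝ, Coord d)) (n := ∞) (x := q)).contMDiffAt
    ((chartAt (Coord d) q).open_source.mem_nhds hq))
  exact h2.comp u h1

/-- Around `u` the chart domain of `q` is reached. -/
theorem transition_eventually (p q : M) {u : Coord d}
    (hu : u ∈ (chartAt (Coord d) p).target)
    (hq : (chartAt (Coord d) p).symm u ∈ (chartAt (Coord d) q).source) :
    ∀ᶠ w in 𝓝 u, w ∈ (chartAt (Coord d) p).target ∧
      (chartAt (Coord d) p).symm w ∈ (chartAt (Coord d) q).source := by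
  refine ((chartAt (Coord d) p).open_target.mem_nhds hu |> Filter.Eventually.and <| ?_)
  exact ((chartAt (Coord d) p).continuousAt_symm hu).eventually
    ((chartAt (Coord d) q).open_source.mem_nhds hq)

theorem mfderiv_symm_eq (p q : M) {u : Coord d}
    (hu : u ∈ (chartAt (Coord d) p).target)
    (hq : (chartAt (Coord d) p).symm u ∈ (chartAt (Coord d) q).source) (v : Coord d) :
    (mfderiv 𝓘(ℝ, Coord d) 𝓘(ℝ, Coord d) (chartAt (Coord d) p).symm u v : Coord d)
      = mfderiv 𝓘(ℝ, Coord d) 𝓘(ℝ, Coord d) (chartAt (Coord d) q).symm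
          (transition (d := d) p q u) (fderiv ℝ (transition (d := d) p q) u v) := by
  have h1 : MDifferentiableAt 𝓘(ℝ, Coord d) 𝓘(ℝ, Coord d) (transition (d := d) p q) u :=
    ((transition_contDiffAt p q hu hq).differentiableAt (by simp)).mdifferentiableAt
  have ht : transition (d := d) p q u ∈ (chartAt (Coord d) q).target :=
    (chartAt (Coord d) q).map_source hq
  have h3 := mfderiv_comp u (symm_mdifferentiableAt q ht) h1
  have h4 : ((chartAt (Coord d) q).symm ∘ transition (d := d) p q)
      =ᶠ[𝓝 u] (chartAt (Coord d) p).symm := by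
    filter_upwards [transition_eventually p q hu hq] with w hw
    exact (chartAt (Coord d) q).left_inv hw.2
  rw [h4.mfderiv_eq, mfderiv_eq_fderiv] at h3
  exact congrArg (fun L => L v) h3

/-- The bilinear form of the metric, read on the coordinate space. -/
def formAt (g : LorentzianMetric d M) (x : M) : LinearMap.BilinForm ℝ (Coord d) := g.form x

/-- Change of the metric coefficients under a change of charts. -/
theorem metricCoord_transition (g : LorentzianMetric d M) (p q : M) {u : Coord d}
    (hu : u ∈ (chartAt (Coord d) p).target)
    (hq : (chartAt (Coord d) p).symm u ∈ (chartAt (Coord d) q).source) :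
    metricCoord g.form p u
      = (jacobiMatrix (transition (d := d) p q) u).transpose
        * metricCoord g.form q (transition (d := d) p q u)
        * jacobiMatrix (transition (d := d) p q) u := by
  set A := jacobiMatrix (transition (d := d) p q) u with hA
  set L : Coord d →L[ℝ] Coord d := mfderiv 𝓘(ℝ, Coord d) 𝓘(ℝ, Coord d)
    (chartAt (Coord d) q).symm (transition (d := d) p q u) with hL
  have hx : (chartAt (Coord d) q).symm (transition (d := d) p q u)
      = (chartAt (Coord d) p).symm u := (chartAt (Coord d) q).left_inv hq
  have hq' : ∀ k l, metricCoord g.form q (transition (d := d) p q u) k l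
      = g.formAt ((chartAt (Coord d) p).symm u) (L (basisVec k)) (L (basisVec l)) := by
    intro k l
    rw [← hx]
    rfl
  have hp' : ∀ i j, metricCoord g.form p u i j
      = g.formAt ((chartAt (Coord d) p).symm u)
        (L (fderiv ℝ (transition (d := d) p q) u (basisVec i)))
        (L (fderiv ℝ (transition (d := d) p q) u (basisVec j))) := by
    intro i j
    have h1 := mfderiv_symm_eq p q hu hq (basisVec i)
    have h2 := mfderiv_symm_eq p q hu hq (basisVec j)
    change g.formAt _ _ _ = _
    exact congrArg₂ (fun a b => g.formAt ((chartAt (Coord d) p).symm u) a b) h1 h2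
  ext i j
  rw [hp', fderiv_basisVec, fderiv_basisVec]
  simp only [map_sum, map_smul, LinearMap.sum_apply, LinearMap.smul_apply, smul_eq_mul,
    Matrix.mul_apply, Matrix.transpose_apply, hq', Finset.sum_mul, Finset.mul_sum]
  refine Finset.sum_congr rfl fun k _ => Finset.sum_congr rfl fun l _ => ?_
  rw [hA]
  ring

theorem det_metricCoord_ne_zero (g : LorentzianMetric d M) (p : M) {u : Coord d}
    (hu : u ∈ (chartAt (Coord d) p).target) : (metricCoord g.form p u).det ≠ 0 := by
  intro h0
  obtain ⟨v, hv0, hv⟩ := Matrix.exists_mulVec_eq_zero_iff.2 h0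
  set L : Coord d →L[ℝ] Coord d := mfderiv 𝓘(ℝ, Coord d) 𝓘(ℝ, Coord d)
    (chartAt (Coord d) p).symm u with hL
  have hLi : Function.Injective L := mfderiv_symm_injective p hu
  have hLs : Function.Surjective L :=
    (LinearMap.injective_iff_surjective (f := (L : Coord d →ₗ[ℝ] Coord d))).1 hLi
  set V : Coord d := ∑ j, v j • (basisVec j : Coord d) with hV
  have hVv : ∀ j, V j = v j := by
    intro j
    simp [hV, Finset.sum_apply, Pi.single_apply]
  set B := g.formAt ((chartAt (Coord d) p).symm u) with hB
  have h1 : ∀ i, B (L (basisVec i)) (L V) = 0 := by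
    intro i
    have := congrFun hv i
    rw [hV]
    simp only [map_sum, map_smul, smul_eq_mul]
    simp only [Matrix.mulVec, dotProduct, Pi.zero_apply] at this
    rw [← this]
    refine Finset.sum_congr rfl fun j _ => ?_
    rw [mul_comm]
    rfl
  have h2 : ∀ X, B (L X) (L V) = 0 := by
    intro X
    have hX : X = ∑ i, X i • (basisVec i : Coord d) := by
      ext k
      simp [Finset.sum_apply, Pi.single_apply]
    rw [hX]
    simp [map_sum, map_smul, LinearMap.sum_apply, LinearMap.smul_apply, h1]
  obtain ⟨e, he⟩ := g.signature ((chartAt (Coord d) p).symm u)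
  have h3 : ∀ i, e.repr (L V) i = 0 := by
    intro i
    obtain ⟨X, hX⟩ := hLs (e i)
    have h4 : g.form ((chartAt (Coord d) p).symm u) (e i) (L V) = 0 := by
      have := h2 X
      rw [hX] at this
      exact this
    rw [← e.sum_repr (L V)] at h4
    simp only [map_sum, map_smul, he, minkowskiEntry, smul_eq_mul, mul_ite, mul_zero,
      Finset.sum_ite_eq, Finset.mem_univ, if_true] at h4
    split_ifs at h4
    · simpa using h4
    · simpa using h4
  have h5 : L V = 0 := by
    rw [← e.sum_repr (L V)]
    exact Finset.sum_eq_zero fun i _ => (by rw [h3 i]; exact zero_smul ℝ (e i))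
  have h6 : V = 0 := hLi (by simpa using h5)
  exact hv0 (by funext j; rw [← hVv j, h6]; rfl)

theorem density_pos_of_det {g : LorentzianMetric d M} {p : M} {u : Coord d}
    (h : (metricCoord g.form p u).det ≠ 0) : 0 < g.density p u :=
  Real.sqrt_pos.2 (abs_pos.2 h)

theorem det_jacobi_ne_zero (g : LorentzianMetric d M) (p q : M) {u : Coord d}
    (hu : u ∈ (chartAt (Coord d) p).target)
    (hq : (chartAt (Coord d) p).symm u ∈ (chartAt (Coord d) q).source) :
    (jacobiMatrix (transition (d := d) p q) u).det ≠ 0 := by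
  have h := g.det_metricCoord_ne_zero p hu
  rw [g.metricCoord_transition p q hu hq] at h
  simp only [Matrix.det_mul, Matrix.det_transpose] at h
  exact right_ne_zero_of_mul h

theorem density_transition (g : LorentzianMetric d M) (p q : M) {u : Coord d}
    (hu : u ∈ (chartAt (Coord d) p).target)
    (hq : (chartAt (Coord d) p).symm u ∈ (chartAt (Coord d) q).source) :
    g.density p u = |(jacobiMatrix (transition (d := d) p q) u).det|
      * g.density q (transition (d := d) p q u) := by
  unfold density
  rw [g.metricCoord_transition p q hu hq]
  simp only [Matrix.det_mul, Matrix.det_transpose]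
  rw [show ∀ a b : ℝ, a * b * a = a ^ 2 * b from fun a b => by ring, abs_mul,
    Real.sqrt_mul (abs_nonneg _), abs_pow, Real.sqrt_sq (abs_nonneg _)]

theorem contDiffOn_det (g : LorentzianMetric d M) (p : M) :
    ContDiffOn ℝ ∞ (fun u => (metricCoord g.form p u).det) (chartAt (Coord d) p).target := by
  simp only [Matrix.det_apply']
  exact ContDiffOn.sum fun σ _ => contDiffOn_const.mul
    (contDiffOn_prod fun i _ => g.smooth p _ _)

theorem contDiffOn_density (g : LorentzianMetric d M) (p : M) :
    ContDiffOn ℝ ∞ (g.density p) (chartAt (Coord d) p).target := by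
  unfold density
  refine ContDiffOn.sqrt (ContDiffOn.abs (g.contDiffOn_det p)
    fun u hu => g.det_metricCoord_ne_zero p hu) fun u hu =>
      (abs_pos.2 (g.det_metricCoord_ne_zero p hu)).ne'

theorem contDiffOn_inv (g : LorentzianMetric d M) (p : M) (i j : Fin (d + 1)) :
    ContDiffOn ℝ ∞ (fun u => (metricCoord g.form p u)⁻¹ i j) (chartAt (Coord d) p).target := by
  simp only [Matrix.inv_def, Matrix.smul_apply, Ring.inverse_eq_inv', smul_eq_mul]
  refine ((g.contDiffOn_det p).inv fun u hu => g.det_metricCoord_ne_zero p hu).mul ?_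
  simp only [Matrix.adjugate_apply, Matrix.det_apply']
  refine ContDiffOn.sum fun σ _ => contDiffOn_const.mul (contDiffOn_prod fun k _ => ?_)
  by_cases h : σ k = j
  · simp only [h, Matrix.updateRow_self]
    exact contDiffOn_const
  · simp only [Matrix.updateRow_ne h]
    exact g.smooth p _ _

/-- The coordinate components of `√|det g| grad f`. -/
def flux (g : LorentzianMetric d M) (p : M) (f : M → ℂ) (i : Fin (d + 1)) (w : Coord d) : ℂ :=
  g.density p w • ∑ j, (metricCoord g.form p w)⁻¹ i j •
      fderiv ℝ (f ∘ (chartAt (Coord d) p).symm) w (basisVec j)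

theorem contDiffOn_comp_symm {f : M → ℂ} (hf : ContMDiff 𝓘(ℝ, Coord d) 𝓘(ℝ, ℂ) ∞ f) (p : M) :
    ContDiffOn ℝ ∞ (f ∘ (chartAt (Coord d) p).symm) (chartAt (Coord d) p).target := by
  rw [← contMDiffOn_iff_contDiffOn]
  exact hf.comp_contMDiffOn (contMDiffOn_chart_symm (I := 𝓘(ℝ, Coord d)) (n := ∞) (x := p))

theorem contDiffOn_fderiv_apply {F : Coord d → ℂ} {s : Set (Coord d)} (hs : IsOpen s)
    (hF : ContDiffOn ℝ ∞ F s) (v : Coord d) :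
    ContDiffOn ℝ ∞ (fun w => fderiv ℝ F w v) s :=
  (hF.fderiv_of_isOpen hs (by simp)).clm_apply contDiffOn_const

theorem contDiffOn_flux (g : LorentzianMetric d M) (p : M) {f : M → ℂ}
    (hf : ContMDiff 𝓘(ℝ, Coord d) 𝓘(ℝ, ℂ) ∞ f) (i : Fin (d + 1)) :
    ContDiffOn ℝ ∞ (g.flux p f i) (chartAt (Coord d) p).target :=
  (g.contDiffOn_density p).smul (ContDiffOn.sum fun j _ => (g.contDiffOn_inv p i j).smul
    (contDiffOn_fderiv_apply (chartAt (Coord d) p).open_target (contDiffOn_comp_symm hf p) _))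

theorem contDiffOn_boxChart (g : LorentzianMetric d M) (p : M) {f : M → ℂ}
    (hf : ContMDiff 𝓘(ℝ, Coord d) 𝓘(ℝ, ℂ) ∞ f) :
    ContDiffOn ℝ ∞ (g.boxChart p f) (chartAt (Coord d) p).target :=
  ((g.contDiffOn_density p).inv fun _u hu =>
    (density_pos_of_det (g.det_metricCoord_ne_zero p hu)).ne').smul
    (ContDiffOn.sum fun i _ => contDiffOn_fderiv_apply (chartAt (Coord d) p).open_target
      (g.contDiffOn_flux p hf i) _)

theorem flux_transition (g : LorentzianMetric d M) (p q : M) {f : M → ℂ}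
    (hf : ContMDiff 𝓘(ℝ, Coord d) 𝓘(ℝ, ℂ) ∞ f) {u : Coord d}
    (hu : u ∈ (chartAt (Coord d) p).target)
    (hq : (chartAt (Coord d) p).symm u ∈ (chartAt (Coord d) q).source) (i : Fin (d + 1)) :
    g.flux p f i u = (SignType.sign (jacobiMatrix (transition (d := d) p q) u).det : ℝ) •
      ∑ k, (jacobiMatrix (transition (d := d) p q) u).adjugate i k •
        g.flux q f k (transition (d := d) p q u) := by
  set τ := transition (d := d) p q with hτ
  set A := jacobiMatrix τ u with hA
  have hdet : A.det ≠ 0 := g.det_jacobi_ne_zero p q hu hq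
  have ht : τ u ∈ (chartAt (Coord d) q).target := (chartAt (Coord d) q).map_source hq
  have h1 : (f ∘ (chartAt (Coord d) p).symm)
      =ᶠ[𝓝 u] (f ∘ (chartAt (Coord d) q).symm) ∘ τ := by
    filter_upwards [transition_eventually p q hu hq] with w hw
    exact congrArg f ((chartAt (Coord d) q).left_inv hw.2).symm
  have hfq : DifferentiableAt ℝ (f ∘ (chartAt (Coord d) q).symm) (τ u) :=
    ((contDiffOn_comp_symm hf q).contDiffAt
      ((chartAt (Coord d) q).open_target.mem_nhds ht)).differentiableAt (by simp)
  have hτd : DifferentiableAt ℝ τ u :=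
    (transition_contDiffAt p q hu hq).differentiableAt (by simp)
  set c : Fin (d + 1) → ℂ := fun k =>
    fderiv ℝ (f ∘ (chartAt (Coord d) q).symm) (τ u) (basisVec k) with hc
  have h2 : ∀ j, fderiv ℝ (f ∘ (chartAt (Coord d) p).symm) u (basisVec j)
      = ∑ k, A k j • c k := by
    intro j
    rw [h1.fderiv_eq, fderiv_comp u hfq hτd, ContinuousLinearMap.comp_apply,
      fderiv_basisVec, map_sum]
    simp only [map_smul]
    rfl
  have h3 : (metricCoord g.form p u)⁻¹ * A.transpose
      = A⁻¹ * (metricCoord g.form q (τ u))⁻¹ := by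
    rw [g.metricCoord_transition p q hu hq, Matrix.mul_inv_rev, Matrix.mul_inv_rev]
    rw [Matrix.mul_assoc, Matrix.mul_assoc, Matrix.nonsing_inv_mul _
      (by rw [Matrix.det_transpose]; exact hdet.isUnit), Matrix.mul_one]
  have h4 : A.adjugate = A.det • A⁻¹ := by
    rw [Matrix.inv_def, smul_smul, Ring.inverse_eq_inv', mul_inv_cancel₀ hdet, one_smul]
  have h5 : ∑ j, (metricCoord g.form p u)⁻¹ i j • ∑ k, A k j • c k
      = ∑ k, ((metricCoord g.form p u)⁻¹ * A.transpose) i k • c k := by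
    simp only [Finset.smul_sum, Matrix.mul_apply, Finset.sum_smul, smul_smul,
      Matrix.transpose_apply]
    exact Finset.sum_comm
  have h6 : ∑ k, A⁻¹ i k • ∑ l, (metricCoord g.form q (τ u))⁻¹ k l • c l
      = ∑ l, (A⁻¹ * (metricCoord g.form q (τ u))⁻¹) i l • c l := by
    simp only [Finset.smul_sum, Matrix.mul_apply, Finset.sum_smul, smul_smul]
    exact Finset.sum_comm
  unfold flux
  simp only [h2]
  rw [h5, h3, ← h6, g.density_transition p q hu hq, h4]
  simp only [Matrix.smul_apply, Finset.smul_sum, smul_smul]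
  refine Finset.sum_congr rfl fun k _ => Finset.sum_congr rfl fun l _ => ?_
  congr 1
  rw [← hτ, ← hA, ← sign_mul_self A.det]
  simp only [smul_eq_mul]
  ring

/-- The coordinate expression of the d'Alembertian does not depend on the chart. -/
theorem boxChart_transition (g : LorentzianMetric d M) (p q : M) {f : M → ℂ}
    (hf : ContMDiff 𝓘(ℝ, Coord d) 𝓘(ℝ, ℂ) ∞ f) {u : Coord d}
    (hu : u ∈ (chartAt (Coord d) p).target)
    (hq : (chartAt (Coord d) p).symm u ∈ (chartAt (Coord d) q).source) :
    g.boxChart p f u = g.boxChart q f (transition (d := d) p q u) := by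
  set τ := transition (d := d) p q with hτ
  have hdet : (jacobiMatrix τ u).det ≠ 0 := g.det_jacobi_ne_zero p q hu hq
  have ht : τ u ∈ (chartAt (Coord d) q).target := (chartAt (Coord d) q).map_source hq
  have hτc : ContDiffAt ℝ ∞ τ u := transition_contDiffAt p q hu hq
  have hs : ∀ᶠ w in 𝓝 u, SignType.sign (jacobiMatrix τ w).det
      = SignType.sign (jacobiMatrix τ u).det := by
    have hc : ContinuousAt (fun w => (jacobiMatrix τ w).det) u :=
      (hasFDerivAt_det fun i j => jacobiMatrix_hasFDerivAt hτc i j).continuousAt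
    have hc2 : ContinuousAt (fun w => SignType.sign (jacobiMatrix τ w).det) u :=
      ContinuousAt.comp (f := fun w => (jacobiMatrix τ w).det)
        (continuousAt_sign_of_ne_zero hdet) hc
    exact hc2.eventually ((isOpen_discrete {SignType.sign (jacobiMatrix τ u).det}).mem_nhds rfl)
  have hfl : ∀ i, g.flux p f i =ᶠ[𝓝 u] fun w =>
      (SignType.sign (jacobiMatrix τ u).det : ℝ) •
        ∑ k, (jacobiMatrix τ w).adjugate i k • g.flux q f k (τ w) := by
    intro i
    filter_upwards [transition_eventually p q hu hq, hs] with w hw hsw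
    rw [g.flux_transition p q hf hw.1 hw.2 i, hsw]
  have hY : ∀ k, DifferentiableAt ℝ (g.flux q f k) (τ u) := fun k =>
    ((g.contDiffOn_flux q hf k).contDiffAt
      ((chartAt (Coord d) q).open_target.mem_nhds ht)).differentiableAt (by simp)
  have hdiv := divergence_comp hτc hdet hY
  have h1 : ∑ i, fderiv ℝ (g.flux p f i) u (basisVec i)
      = |(jacobiMatrix τ u).det| • ∑ k, fderiv ℝ (g.flux q f k) (τ u) (basisVec k) := by
    rw [← sign_mul_self (jacobiMatrix τ u).det, mul_smul, ← hdiv, Finset.smul_sum]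
    refine Finset.sum_congr rfl fun i _ => ?_
    rw [(hfl i).fderiv_eq]
    exact congrArg (fun L : Coord d → Coord d →L[ℝ] ℂ => L u (basisVec i))
      (fderiv_const_smul_field (𝕜 := ℝ)
        (f := fun w => ∑ k, (jacobiMatrix τ w).adjugate i k • g.flux q f k (τ w))
        (SignType.sign (jacobiMatrix τ u).det : ℝ))
  change (g.density p u)⁻¹ • ∑ i, fderiv ℝ (g.flux p f i) u (basisVec i)
    = (g.density q (τ u))⁻¹ • ∑ i, fderiv ℝ (g.flux q f i) (τ u) (basisVec i)
  rw [h1, smul_smul, g.density_transition p q hu hq, mul_inv, ← hτ]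
  congr 1
  rw [mul_comm, ← mul_assoc, mul_inv_cancel₀ (abs_ne_zero.2 hdet), one_mul]

/-- The d'Alembertian of a smooth function is smooth. -/
theorem contMDiff_box (g : LorentzianMetric d M) {f : M → ℂ}
    (hf : ContMDiff 𝓘(ℝ, Coord d) 𝓘(ℝ, ℂ) ∞ f) :
    ContMDiff 𝓘(ℝ, Coord d) 𝓘(ℝ, ℂ) ∞ (g.box f) := by
  intro p
  have h1 : ContMDiffAt 𝓘(ℝ, Coord d) 𝓘(ℝ, ℂ) ∞
      (fun x => g.boxChart p f (chartAt (Coord d) p x)) p :=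
    (((g.contDiffOn_boxChart p hf).contDiffAt ((chartAt (Coord d) p).open_target.mem_nhds
      (mem_chart_target _ p))).contMDiffAt).comp p
      ((contMDiffOn_chart (I := 𝓘(ℝ, Coord d)) (n := ∞) (x := p)).contMDiffAt
        ((chartAt (Coord d) p).open_source.mem_nhds (mem_chart_source _ p)))
  refine h1.congr_of_eventuallyEq ?_
  filter_upwards [(chartAt (Coord d) p).open_source.mem_nhds (mem_chart_source _ p)] with x hx
  have h2 := g.boxChart_transition x p hf (mem_chart_target (Coord d) x)
    (by rw [(chartAt (Coord d) x).left_inv (mem_chart_source _ x)]; exact hx)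
  have h3 : transition (d := d) x p (chartAt (Coord d) x x) = chartAt (Coord d) p x := by
    unfold transition
    rw [(chartAt (Coord d) x).left_inv (mem_chart_source _ x)]
  rw [h3] at h2
  exact h2

theorem box_eq_zero (g : LorentzianMetric d M) {f : M → ℂ} {x : M} (hf : f =ᶠ[𝓝 x] 0) :
    g.box f x = 0 := by
  set u := chartAt (Coord d) x x with hu
  have hut : u ∈ (chartAt (Coord d) x).target := mem_chart_target _ x
  have hx : (chartAt (Coord d) x).symm u = x :=
    (chartAt (Coord d) x).left_inv (mem_chart_source _ x)
  have h1 : ∀ᶠ w in 𝓝 u, (f ∘ (chartAt (Coord d) x).symm) w = 0 := by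
    have hc := (chartAt (Coord d) x).continuousAt_symm hut
    rw [ContinuousAt, hx] at hc
    exact hc.eventually hf
  have h2 : ∀ i, g.flux x f i =ᶠ[𝓝 u] fun _ => 0 := by
    intro i
    filter_upwards [h1.eventually_nhds] with w hw
    have : fderiv ℝ (f ∘ (chartAt (Coord d) x).symm) w = 0 := by
      rw [Filter.EventuallyEq.fderiv_eq (f := fun _ => (0 : ℂ)) hw]
      simp
    simp [flux, this]
  change (g.density x u)⁻¹ • ∑ i, fderiv ℝ (g.flux x f i) u (basisVec i) = 0
  simp [(h2 _).fderiv_eq]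

end
end LorentzianMetric
section TestFunctions

variable (d : ℕ) (M : Type*) [TopologicalSpace M] [ChartedSpace (Coord d) M]

variable {d M} in
theorem smooth_mul {f h : M → ℂ} (hf : ContMDiff 𝓘(ℝ, Coord d) 𝓘(ℝ, ℂ) ∞ f)
    (hh : ContMDiff 𝓘(ℝ, Coord d) 𝓘(ℝ, ℂ) ∞ h) :
    ContMDiff 𝓘(ℝ, Coord d) 𝓘(ℝ, ℂ) ∞ (fun x => f x * h x) :=
  (contDiff_mul (𝕜 := ℝ) (𝔸 := ℂ)).contMDiff.comp (hf.prodMk_space hh)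

/-- The space `C^∞(M, ℂ)`. -/
def SmoothFun : Submodule ℂ (M → ℂ) where
  carrier := {f | ContMDiff 𝓘(ℝ, Coord d) 𝓘(ℝ, ℂ) ∞ f}
  add_mem' hf hg := hf.add hg
  zero_mem' := contMDiff_const
  smul_mem' _ _ hf := smooth_mul contMDiff_const hf

/-- The space `𝒟(M, ℂ)` of smooth complex functions of compact support. -/
def TestFun : Submodule ℂ (M → ℂ) where
  carrier := {f | ContMDiff 𝓘(ℝ, Coord d) 𝓘(ℝ, ℂ) ∞ f ∧ HasCompactSupport f}
  add_mem' hf hg := ⟨hf.1.add hg.1, hf.2.add hg.2⟩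
  zero_mem' := ⟨contMDiff_const, HasCompactSupport.zero⟩
  smul_mem' _ _ hf := ⟨smooth_mul contMDiff_const hf.1, hf.2.mul_left⟩

variable {d M}

/-- Complex conjugation of test functions. -/
def conjTest (f : TestFun d M) : TestFun d M :=
  ⟨fun x => starRingEnd ℂ (f.1 x),
    Complex.conjCLE.contDiff.contMDiff.comp f.2.1, f.2.2.comp_left (map_zero _)⟩

/-- The product of a test function and a smooth function. -/
def mulSmooth (χ : TestFun d M) (h : SmoothFun d M) : TestFun d M :=
  ⟨fun x => χ.1 x * h.1 x, smooth_mul χ.2.1 h.2, χ.2.2.mul_right⟩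

/-- The transported test function `f_α = f ∘ α⁻¹`. -/
def transport (α : Diffeomorph 𝓘(ℝ, Coord d) 𝓘(ℝ, Coord d) M M ∞)
    (f : TestFun d M) : TestFun d M :=
  ⟨fun x => f.1 (α.symm x), f.2.1.comp α.symm.contMDiff,
    f.2.2.comp_homeomorph α.symm.toHomeomorph⟩

/-- `F j → 0` in `C^∞(M, ℂ)`: in every chart all derivatives converge to zero uniformly on
compact sets. -/
def NullSeqSmooth (F : ℕ → M → ℂ) : Prop :=
  ∀ (p : M) (k : ℕ) (K : Set (Coord d)), IsCompact K → K ⊆ (chartAt (Coord d) p).target →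
    TendstoUniformlyOn
      (fun j u => iteratedFDeriv ℝ k (F j ∘ (chartAt (Coord d) p).symm) u) 0 atTop K

/-- `F j → 0` in `𝒟(M, ℂ)`: the supports stay in a common compact set and `F j → 0` together
with all derivatives. -/
def NullSeqTest (F : ℕ → TestFun d M) : Prop :=
  (∃ K : Set M, IsCompact K ∧ ∀ j, tsupport (F j).1 ⊆ K) ∧
    NullSeqSmooth (d := d) fun j => (F j).1

/-- The values `u(f₁ ⊗ ⋯ ⊗ fₙ)` of an element of `𝒟(M^n, ℂ)'`: a functional that is linear in
each of `n` test functions and jointly continuous along sequences that converge in `𝒟(M, ℂ)`. -/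
structure IsDistribution {n : ℕ} (u : (Fin n → TestFun d M) → ℂ) : Prop where
  multilinear : ∃ L : MultilinearMap ℂ (fun _ : Fin n => TestFun d M) ℂ, ∀ f, L f = u f
  continuous : ∀ (F : ℕ → Fin n → TestFun d M) (f : Fin n → TestFun d M),
    (∀ l, NullSeqTest fun j => F j l - f l) →
      Tendsto (fun j => u (F j)) atTop (𝓝 (u f))

/-- A sequence of test functions with values in `[0, 1]` each compact set of which is eventually
contained in the set where they are equal to `1`. -/
def IsCutoff (χ : ℕ → TestFun d M) : Prop :=
  (∀ j x, ∃ r : ℝ, 0 ≤ r ∧ r ≤ 1 ∧ (χ j).1 x = r) ∧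
    ∀ K : Set M, IsCompact K → ∀ᶠ j in atTop, ∀ x ∈ K, (χ j).1 x = 1

/-- The Klein-Gordon operator `□ + m²` on test functions. -/
def kleinGordon [IsManifold 𝓘(ℝ, Coord d) ∞ M] (g : LorentzianMetric d M) (m : ℝ)
    (f : TestFun d M) : TestFun d M :=
  ⟨fun x => g.box f.1 x + (m : ℂ) ^ 2 * f.1 x,
    (g.contMDiff_box f.2.1).add (smooth_mul contMDiff_const f.2.1), by
      refine f.2.2.mono' fun x hx => ?_
      by_contra hx'
      refine hx ?_
      have h : f.1 =ᶠ[𝓝 x] 0 := notMem_tsupport_iff_eventuallyEq.1 hx'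
      change _ + _ = _
      rw [g.box_eq_zero h, h.eq_of_nhds]
      simp⟩

end TestFunctions

section Spacetime

variable {d : ℕ} {M : Type*} [TopologicalSpace M] [ChartedSpace (Coord d) M]

/-- The value `dt(v)` of the differential of a real function on a tangent vector. -/
def rate (t : M → ℝ) (x : M) (v : TangentSpace 𝓘(ℝ, Coord d) x) : ℝ :=
  mfderiv 𝓘(ℝ, Coord d) 𝓘(ℝ, ℝ) t x v

/-- A time function `t` orients the cones of `g`: no non-zero causal vector is in the kernel
of `dt`, the causal vectors with `dt > 0` being the future directed ones. -/
def IsTemporal (g : LorentzianMetric d M) (t : M → ℝ) : Prop :=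
  ∀ (x : M) (v : TangentSpace 𝓘(ℝ, Coord d) x), v ≠ 0 → 0 ≤ g.form x v v →
    rate t x v ≠ 0

/-- The velocity of a curve. -/
def velocity (c : ℝ → M) (s : ℝ) : TangentSpace 𝓘(ℝ, Coord d) (c s) :=
  mfderiv 𝓘(ℝ, ℝ) 𝓘(ℝ, Coord d) c s (1 : ℝ)

/-- `x ≤ y`: either `x = y` or there is a future directed causal curve from `x` to `y`. -/
def CausallyPrecedes (g : LorentzianMetric d M) (t : M → ℝ) (x y : M) : Prop :=
  x = y ∨ ∃ c : ℝ → M, ContMDiff 𝓘(ℝ, ℝ) 𝓘(ℝ, Coord d) 1 c ∧ c 0 = x ∧ c 1 = y ∧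
    ∀ s ∈ Icc (0 : ℝ) 1, 0 ≤ g.form (c s) (velocity (d := d) c s) (velocity (d := d) c s) ∧
      0 < rate t (c s) (velocity (d := d) c s)

/-- The union of the closed forward light-cones of the points of `A`. -/
def causalFuture (g : LorentzianMetric d M) (t : M → ℝ) (A : Set M) : Set M :=
  {y | ∃ x ∈ A, CausallyPrecedes g t x y}

/-- The union of the closed backward light-cones of the points of `A`. -/
def causalPast (g : LorentzianMetric d M) (t : M → ℝ) (A : Set M) : Set M :=
  {y | ∃ x ∈ A, CausallyPrecedes g t y x}

/-- A globally hyperbolic space-time `M ≅ ℝ × S` of dimension `1 + d`, whose time direction is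
given by the order of `ℝ`. Global hyperbolicity is the absence of closed causal curves, which
follows from the temporal function, together with the compactness of the causally convex hulls
of the compact sets. -/
structure Spacetime (d : ℕ) (M : Type*) [TopologicalSpace M] [ChartedSpace (Coord d) M]
    (S : Type*) [TopologicalSpace S] [ChartedSpace (EuclideanSpace ℝ (Fin d)) S] where
  /-- the metric -/
  metric : LorentzianMetric d M
  /-- the diffeomorphism onto the product -/
  splitting : Diffeomorph 𝓘(ℝ, Coord d)
    (𝓘(ℝ, ℝ).prod 𝓘(ℝ, EuclideanSpace ℝ (Fin d))) M (ℝ × S) ∞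
  temporal : IsTemporal metric fun x => (splitting x).1
  compact_hull : ∀ K : Set M, IsCompact K →
    IsCompact (causalFuture metric (fun x => (splitting x).1) K ∩
      causalPast metric (fun x => (splitting x).1) K)

namespace Spacetime

variable {S : Type*} [TopologicalSpace S] [ChartedSpace (EuclideanSpace ℝ (Fin d)) S]

/-- The time coordinate. -/
def time (X : Spacetime d M S) (x : M) : ℝ := (X.splitting x).1

/-- `𝒢^↑(M, g)`: isometric diffeomorphisms that preserve the time direction. -/
structure IsTimeIsometry (X : Spacetime d M S)
    (α : Diffeomorph 𝓘(ℝ, Coord d) 𝓘(ℝ, Coord d) M M ∞) : Prop where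
  isometric : ∀ (x : M) (v w : TangentSpace 𝓘(ℝ, Coord d) x),
    X.metric.form (α x) (mfderiv 𝓘(ℝ, Coord d) 𝓘(ℝ, Coord d) α x v)
      (mfderiv 𝓘(ℝ, Coord d) 𝓘(ℝ, Coord d) α x w) = X.metric.form x v w
  orthochronous : ∀ (x : M) (v : TangentSpace 𝓘(ℝ, Coord d) x), 0 ≤ X.metric.form x v v →
    0 < rate X.time x v →
    0 < rate X.time (α x) (mfderiv 𝓘(ℝ, Coord d) 𝓘(ℝ, Coord d) α x v)

variable [IsManifold 𝓘(ℝ, Coord d) ∞ M] [MeasurableSpace M]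

/-- The bilinear form `A(f, h) = ∫ A(f, y) h(y) dy` of a kernel `f ↦ A(f, ·)`. -/
def pairing (X : Spacetime d M S) (A : TestFun d M → M → ℂ) (f h : TestFun d M) : ℂ :=
  ∫ y, A f y * h.1 y ∂X.metric.volumeMeasure

/-- A real fundamental solution of `□ + m²`, given by the smooth functions `G(f, ·)`, with
`supp G(f, ·) ⊆ J (supp f)`. -/
structure IsFundamentalSolution (X : Spacetime d M S) (m : ℝ) (J : Set M → Set M)
    (G : TestFun d M →ₗ[ℂ] SmoothFun d M) : Prop where
  distribution : IsDistribution fun f : Fin 2 → TestFun d M =>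
    X.pairing (fun f => (G f).1) (f 0) (f 1)
  real : ∀ f y, (G (conjTest f)).1 y = starRingEnd ℂ ((G f).1 y)
  support : ∀ f, tsupport (G f).1 ⊆ J (tsupport f.1)
  left_inverse : ∀ f h, X.pairing (fun f => (G f).1) (kleinGordon X.metric m f) h
    = ∫ y, f.1 y * h.1 y ∂X.metric.volumeMeasure
  right_inverse : ∀ f h, X.pairing (fun f => (G f).1) f (kleinGordon X.metric m h)
    = ∫ y, f.1 y * h.1 y ∂X.metric.volumeMeasure

/-- The retarded fundamental solution: `supp G_r(f, ·)` lies in the past of `supp f`. -/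
def IsRetarded (X : Spacetime d M S) (m : ℝ) (G : TestFun d M →ₗ[ℂ] SmoothFun d M) : Prop :=
  X.IsFundamentalSolution m (causalPast X.metric X.time) G

/-- The advanced fundamental solution: `supp G_a(f, ·)` lies in the future of `supp f`. -/
def IsAdvanced (X : Spacetime d M S) (m : ℝ) (G : TestFun d M →ₗ[ℂ] SmoothFun d M) : Prop :=
  X.IsFundamentalSolution m (causalFuture X.metric X.time) G

/-- The conditions on `D⁺`, given by the kernel functions `D⁺(f, ·)`, relative to the
retarded and the advanced fundamental solutions. -/
structure IsVacuumTwoPoint (X : Spacetime d M S) (m : ℝ)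
    (Gr Ga : TestFun d M →ₗ[ℂ] SmoothFun d M) (Dp : TestFun d M →ₗ[ℂ] (M → ℂ)) : Prop where
  measurable : ∀ f, Measurable (Dp f)
  locallyIntegrable : ∀ f, LocallyIntegrable (Dp f) X.metric.volumeMeasure
  distribution : IsDistribution fun f : Fin 2 → TestFun d M => X.pairing Dp (f 0) (f 1)
  imaginary_part : ∀ f h,
    X.pairing Dp f h - starRingEnd ℂ (X.pairing Dp (conjTest f) (conjTest h))
      = 2 * Complex.I * (X.pairing (fun f => (Gr f).1) f h - X.pairing (fun f => (Ga f).1) f h)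
  hermitian : ∀ f h, X.pairing Dp h f = starRingEnd ℂ (X.pairing Dp (conjTest f) (conjTest h))
  kleinGordon_left : ∀ f h, X.pairing Dp (kleinGordon X.metric m f) h = 0
  kleinGordon_right : ∀ f h, X.pairing Dp f (kleinGordon X.metric m h) = 0
  invariant : ∀ α, X.IsTimeIsometry α → ∀ f h,
    X.pairing Dp (transport α f) (transport α h) = X.pairing Dp f h
  positive : ∀ f, 0 ≤ (X.pairing Dp (conjTest f) f).re ∧ (X.pairing Dp (conjTest f) f).im = 0

/-- The `n`-point dispersion condition. -/
structure Dispersion (X : Spacetime d M S) (Dp : TestFun d M →ₗ[ℂ] (M → ℂ)) (n : ℕ) : Prop where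
  integrable : ∀ f, Integrable (fun x => ‖Dp f x‖ ^ n) X.metric.volumeMeasure
  pointwise : ∀ F : ℕ → TestFun d M, NullSeqTest F →
    ∀ x, Tendsto (fun j => Dp (F j) x) atTop (𝓝 0)
  dominated : ∀ F : ℕ → TestFun d M, NullSeqTest F →
    ∃ H : M → ℝ, Measurable H ∧ (∀ j x, ‖Dp (F j) x‖ ≤ H x) ∧
      ∀ f, Integrable (fun x => H x * ‖Dp f x‖ ^ (n - 1)) X.metric.volumeMeasure

end Spacetime

end Spacetime

section Ansatz

variable {d : ℕ} {M : Type*} [TopologicalSpace M] [ChartedSpace (Coord d) M]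
  {S : Type*} [TopologicalSpace S] [ChartedSpace (EuclideanSpace ℝ (Fin d)) S]

/-- The kernel `D⁻(f, y)`, the complex conjugate of `D⁺(f̄, y)`. -/
def minusKernel (Dp : TestFun d M →ₗ[ℂ] (M → ℂ)) (f : TestFun d M) (y : M) : ℂ :=
  starRingEnd ℂ (Dp (conjTest f) y)

/-- The integrand `∏_{l<k} D⁻(f_l, y) · h(y) · ∏_{l>k} D⁺(f_l, y)`. -/
def vertex (Dp : TestFun d M →ₗ[ℂ] (M → ℂ)) {n : ℕ} (k : Fin n) (h : M → ℂ)
    (f : Fin n → TestFun d M) (y : M) : ℂ :=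
  (∏ l ∈ Finset.Iio k, minusKernel Dp (f l) y) * h y * ∏ l ∈ Finset.Ioi k, Dp (f l) y

/-- The two fields: the incoming field and the local field. -/
inductive FieldKind : Type
  | incoming
  | loc

/-- A family of functionals `⟨Ψ₀, φ^{a₁}(f₁) ⋯ φ^{aₙ}(fₙ) Ψ₀⟩`, `aᵢ ∈ {in, loc}`. -/
abbrev Correlators (d : ℕ) (M : Type*) [TopologicalSpace M] [ChartedSpace (Coord d) M] : Type _ :=
  ∀ n : ℕ, (Fin n → FieldKind) → (Fin n → TestFun d M) → ℂ

/-- The Wightman functions with given truncated functions: the sum over the partitions of the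
index set of the products of the truncated functions of the blocks, in increasing order. -/
def ofTruncated (T : Correlators d M) : Correlators d M := fun n a f =>
  ∑ P : Finpartition (Finset.univ : Finset (Fin n)), ∏ B ∈ P.parts,
    T B.card (fun i => a (B.orderEmbOfFin rfl i)) (fun i => f (B.orderEmbOfFin rfl i))

variable [IsManifold 𝓘(ℝ, Coord d) ∞ M] [MeasurableSpace M]

open FieldKind in
/-- The relativistic ansatz for the Wightman functions `W` and the truncated functions `T`,
with the Yang-Feldman asymptotic condition and a free incoming field in a quasi-free
representation. A current `j(f)` is the local field at `(□ + m²) f`; as `G_r f` need not have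
compact support, `j(G_r f)` is the limit of `j(χ_N G_r f)` along every cut-off sequence `χ_N`. -/
structure IsSolution (X : Spacetime d M S) (m b : ℝ) (bn : ℕ → ℝ)
    (Gr : TestFun d M →ₗ[ℂ] SmoothFun d M) (Dp : TestFun d M →ₗ[ℂ] (M → ℂ))
    (W T : Correlators d M) : Prop where
  truncation : W = ofTruncated T
  one_point : ∀ f, T 1 (fun _ => loc) f = 0
  two_point : ∀ f, T 2 (fun _ => loc) f = (b ^ 2 / m ^ 2 : ℝ) * X.pairing Dp (f 0) (f 1)
  one_current : ∀ n, 3 ≤ n → ∀ (k : Fin n) (f : Fin n → TestFun d M),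
    T n (fun _ => loc) (Function.update f k (kleinGordon X.metric m (f k)))
      = (bn n : ℂ) * ∫ y, vertex Dp k (f k).1 f y ∂X.metric.volumeMeasure
  two_currents : ∀ (n : ℕ) (k r : Fin n), k ≠ r → ∀ f : Fin n → TestFun d M,
    T n (fun _ => loc) (Function.update (Function.update f k (kleinGordon X.metric m (f k)))
      r (kleinGordon X.metric m (f r))) = 0
  incoming_two_point : ∀ f,
    T 2 (fun _ => incoming) f = (b ^ 2 / m ^ 2 : ℝ) * X.pairing Dp (f 0) (f 1)
  incoming_quasi_free : ∀ n, n ≠ 2 → ∀ f, T n (fun _ => incoming) f = 0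
  yang_feldman : ∀ (n : ℕ) (a : Fin n → FieldKind) (k : Fin n), a k = loc →
    ∀ (f : Fin n → TestFun d M) (χ : ℕ → TestFun d M), IsCutoff χ →
      Tendsto (fun N => T n a
        (Function.update f k (kleinGordon X.metric m (mulSmooth (χ N) (Gr (f k))))))
        atTop (𝓝 (T n a f - T n (Function.update a k incoming) f))

end Ansatz
end CurvedQFT
end

/-! Existence is by an explicit formula. For n ≥ 3 the truncated function of a word is `b_n` times
the sum, over the local letters k only, of the vertex integral with `G_r` in slot k, `D⁻` to its
left and `D⁺` to its right. The two-point functions are the same multiple of `D⁺` for all words, and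
the zero- and one-point functions vanish. As kernel functions, `D⁺` and `D⁻` vanish almost
everywhere on currents, while `G_r ((□ + m²) g) = g`. So a current in slot k kills every term except
the k-th, where it replaces `G_r` by its own test function, and a second current kills that term
too. Turning letter k from local to incoming removes exactly the k-th term, which is the
Yang–Feldman condition once the cut-offs are removed by dominated convergence
(`truncatedSolution_current`, `isSolution_truncatedSolution`).

The analytic point is that all legs lie in `L^n`, so that Hölder's inequality applies. For `D⁺` and
`D⁻` this is the dispersion condition. For `G_r f`, split `M` by the compact hull of `supp f`. On
the hull `G_r f` is bounded. In the past but off the hull `G_a f` vanishes, so `2i G_r f = D⁺f -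
D⁻f`. Elsewhere `G_r f` is zero (`norm_retarded_le`).

Joint continuity requires the `L^n` norms of the legs to tend to zero along null sequences. By
Fatou's lemma, `f ↦ ‖D⁺f‖` in `L^n` is lower semicontinuous along convergent sequences. In a chart
the test functions with support in a fixed compact set form a barrelled space, where lower
semicontinuous seminorms are continuous, and a partition of unity reduces the general case to charts
(`seminorm_tendsto_zero`). The same principle applied to the supremum of `G_r f` over a compact set
controls `G_r f` on the hull.

Uniqueness uses Yang–Feldman as a recursion. If inserting a current in a local slot gives zero, that
letter may be made incoming at no cost (`incoming_eq`). Hence two currents vanish in mixed words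
too, and one-current functions of mixed words are determined. Starting from the prescribed
all-incoming words, Yang–Feldman then determines every word (`truncated_unique`). -/

noncomputable section

namespace CurvedQFT

/-! ### The volume measure is locally finite and positive on open sets. -/

section VolumeMeasure

variable {d : ℕ} {M : Type*} [TopologicalSpace M] [ChartedSpace (Coord d) M]

namespace LorentzianMetric

/-- The measure `√|det (g_{ij})| du` of the chart around `p`, as a measure on the manifold. -/
def chartMeasure [MeasurableSpace M] (g : LorentzianMetric d M) (p : M) : Measure M :=
  (((volume : Measure (Coord d)).restrict (chartAt (Coord d) p).target).withDensity
    (fun u => ENNReal.ofReal (g.density p u))).map (chartAt (Coord d) p).symm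

theorem volumeMeasure_eq_iSup [MeasurableSpace M] (g : LorentzianMetric d M) :
    g.volumeMeasure = ⨆ p : M, g.chartMeasure p := rfl

variable [IsManifold 𝓘(ℝ, Coord d) ∞ M] [MeasurableSpace M] [BorelSpace M]

/-- The inverse chart is continuous only on its target, so measurability is obtained in the subtype
of the target and carried back along the inclusion of an open set. -/
theorem measurableSet_symm_preimage (p : M) {A : Set M} (hA : MeasurableSet A) :
    MeasurableSet ((chartAt (Coord d) p).target ∩ (chartAt (Coord d) p).symm ⁻¹' A) := by
  have h : Measurable ((chartAt (Coord d) p).target.domRestrict (chartAt (Coord d) p).symm) :=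
    (chartAt (Coord d) p).continuousOn_symm.domRestrict.measurable
  have h2 := (chartAt (Coord d) p).open_target.measurableSet.subtype_image (h hA)
  convert h2 using 1
  ext u
  simp [Set.domRestrict, and_comm]

/-- `Measure.map` takes the value zero on maps that are not a.e. measurable. The inverse chart is
a.e. measurable here because the measure is restricted to the target, where it is continuous. -/
theorem chartMeasure_apply (g : LorentzianMetric d M) (p : M) {A : Set M}
    (hA : MeasurableSet A) :
    g.chartMeasure p A = ∫⁻ u in (chartAt (Coord d) p).target ∩ (chartAt (Coord d) p).symm ⁻¹' A,
      ENNReal.ofReal (g.density p u) := by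
  have ht := (chartAt (Coord d) p).open_target.measurableSet
  have h1 : AEMeasurable (chartAt (Coord d) p).symm
      ((volume : Measure (Coord d)).restrict (chartAt (Coord d) p).target) :=
    (chartAt (Coord d) p).continuousOn_symm.aemeasurable ht
  have hnull : NullMeasurableSet ((chartAt (Coord d) p).symm ⁻¹' A)
      ((volume : Measure (Coord d)).restrict (chartAt (Coord d) p).target) :=
    h1.nullMeasurableSet_preimage hA
  unfold chartMeasure
  rw [Measure.map_apply_of_aemeasurable
    (h1.mono_ac (withDensity_absolutelyContinuous _ _)) hA, withDensity_apply₀ _ hnull,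
    Measure.restrict_restrict₀ hnull, inter_comm]

theorem fderiv_det_eq_jacobiMatrix (τ : Coord d → Coord d) (u : Coord d) :
    (fderiv ℝ τ u).det = (jacobiMatrix τ u).det := by
  rw [ContinuousLinearMap.det, ← LinearMap.det_toMatrix
    (EuclideanSpace.basisFun (Fin (d + 1)) ℝ).toBasis]
  congr 1

/-- The measures of two charts agree where both are defined. -/
theorem chartMeasure_eq (g : LorentzianMetric d M) (p q : M) {A : Set M} (hA : MeasurableSet A)
    (hp : A ⊆ (chartAt (Coord d) p).source) (hq : A ⊆ (chartAt (Coord d) q).source) :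
    g.chartMeasure p A = g.chartMeasure q A := by
  rw [chartMeasure_apply g p hA, chartMeasure_apply g q hA]
  set s := (chartAt (Coord d) p).target ∩ (chartAt (Coord d) p).symm ⁻¹' A with hs
  have himg : (chartAt (Coord d) q).target ∩ (chartAt (Coord d) q).symm ⁻¹' A
      = transition (d := d) p q '' s := by
    ext u
    constructor
    · rintro ⟨hu, huA⟩
      refine ⟨chartAt (Coord d) p ((chartAt (Coord d) q).symm u), ⟨?_, ?_⟩, ?_⟩
      · exact (chartAt (Coord d) p).map_source (hp huA)
      · simpa [(chartAt (Coord d) p).left_inv (hp huA)] using huA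
      · simp only [transition]
        rw [(chartAt (Coord d) p).left_inv (hp huA), (chartAt (Coord d) q).right_inv hu]
    · rintro ⟨w, ⟨hw, hwA⟩, rfl⟩
      refine ⟨(chartAt (Coord d) q).map_source (hq hwA), ?_⟩
      simp only [transition, mem_preimage]
      rw [(chartAt (Coord d) q).left_inv (hq hwA)]
      exact hwA
  have hinj : InjOn (transition (d := d) p q) s := by
    rintro u ⟨hu, huA⟩ w ⟨hw, hwA⟩ h
    have := (chartAt (Coord d) q).injOn (hq huA) (hq hwA) h
    exact (chartAt (Coord d) p).symm.injOn hu hw this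
  -- The Jacobian factor of the change of variables is the factor by which the two densities differ.
  rw [himg, lintegral_image_eq_lintegral_abs_det_fderiv_mul volume
    (measurableSet_symm_preimage p hA)
    (fun u hu => (((transition_contDiffAt p q hu.1 (hq hu.2)).differentiableAt
      (by simp)).hasFDerivAt).hasFDerivWithinAt) hinj]
  refine setLIntegral_congr_fun (measurableSet_symm_preimage p hA) fun u hu => ?_
  rw [fderiv_det_eq_jacobiMatrix, g.density_transition p q hu.1 (hq hu.2),
    ENNReal.ofReal_mul (abs_nonneg _)]

theorem chartMeasure_compl_source (g : LorentzianMetric d M) (p : M) :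
    g.chartMeasure p (chartAt (Coord d) p).sourceᶜ = 0 := by
  rw [chartMeasure_apply g p (chartAt (Coord d) p).open_source.measurableSet.compl]
  have : (chartAt (Coord d) p).target ∩ (chartAt (Coord d) p).symm ⁻¹'
      (chartAt (Coord d) p).sourceᶜ = ∅ := by
    ext u
    simp only [mem_inter_iff, mem_preimage, mem_compl_iff, mem_empty_iff_false, iff_false, not_and,
      not_not]
    exact fun hu => (chartAt (Coord d) p).map_target hu
  rw [this, Measure.restrict_empty, lintegral_zero_measure]

/-- A supremum of measures is not computed set by set, so one measure is exhibited that dominates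
all chart measures: the measure of the chart around p, plus infinitely many times the counting
measure off its source. The second summand is invisible on subsets of the source. -/
theorem volumeMeasure_le_chartMeasure (g : LorentzianMetric d M) (p : M) {A : Set M}
    (hA : MeasurableSet A) (hp : A ⊆ (chartAt (Coord d) p).source) :
    g.volumeMeasure A ≤ g.chartMeasure p A := by
  set s := (chartAt (Coord d) p).source with hs
  have hsm : MeasurableSet s := (chartAt (Coord d) p).open_source.measurableSet
  set ν : Measure M := g.chartMeasure p + ((⊤ : ENNReal) • Measure.count).restrict sᶜ with hν
  have hle : g.volumeMeasure ≤ ν := by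
    rw [volumeMeasure_eq_iSup]
    refine iSup_le fun q => ?_
    refine Measure.le_iff.2 fun B hB => ?_
    have hq := (chartAt (Coord d) q).open_source.measurableSet (α := M)
    -- The chart measure of q does not charge the complement of its own source, and on the overlap
    -- of the two sources the chart measures agree.
    have h0 : g.chartMeasure q (B ∩ s) ≤ g.chartMeasure p B := by
      calc g.chartMeasure q (B ∩ s)
          ≤ g.chartMeasure q ((B ∩ s) ∩ (chartAt (Coord d) q).source)
            + g.chartMeasure q (chartAt (Coord d) q).sourceᶜ := by
            refine (measure_mono ?_).trans (measure_union_le _ _)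
            intro x hx
            by_cases h : x ∈ (chartAt (Coord d) q).source
            · exact Or.inl ⟨hx, h⟩
            · exact Or.inr h
        _ = g.chartMeasure p ((B ∩ s) ∩ (chartAt (Coord d) q).source) := by
            rw [chartMeasure_compl_source, add_zero]
            exact g.chartMeasure_eq q p ((hB.inter hsm).inter hq) inter_subset_right
              (inter_subset_left.trans inter_subset_right)
        _ ≤ _ := measure_mono (inter_subset_left.trans inter_subset_left)
    rw [← measure_inter_add_sdiff B hsm, hν, Measure.add_apply]
    refine add_le_add h0 ?_
    rw [Measure.restrict_apply hB, ← sdiff_eq]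
    rcases (B \ s).eq_empty_or_nonempty with h | h
    · simp [h]
    · have : ((⊤ : ENNReal) • (Measure.count : Measure M)) (B \ s) = ⊤ := by
        rw [Measure.smul_apply, smul_eq_mul, ENNReal.top_mul]
        exact (Measure.count_ne_zero h)
      rw [this]
      exact le_top
  refine (hle A).trans ?_
  rw [hν, Measure.add_apply, Measure.restrict_apply hA, ← sdiff_eq,
    sdiff_eq_empty.2 hp]
  simp

/-- Each point has a compact coordinate neighbourhood, on which the continuous density is bounded.
-/
instance isLocallyFiniteMeasure_volumeMeasure [T2Space M] (g : LorentzianMetric d M) :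
    IsLocallyFiniteMeasure g.volumeMeasure := by
  refine ⟨fun p => ?_⟩
  set e := chartAt (Coord d) p with he
  have hu : e p ∈ e.target := mem_chart_target _ p
  obtain ⟨L, hL, hLt⟩ : ∃ L ∈ 𝓝 (e p), IsCompact L ∧ L ⊆ e.target := by
    obtain ⟨L, h1, h2, h3⟩ := local_compact_nhds (e.open_target.mem_nhds hu)
    exact ⟨L, h1, h3, h2⟩
  refine ⟨e.source ∩ e ⁻¹' L, ?_, ?_⟩
  · exact inter_mem (e.open_source.mem_nhds (mem_chart_source _ p))
      ((e.continuousAt (mem_chart_source _ p)).preimage_mem_nhds hL)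
  have hK : e.source ∩ e ⁻¹' L = e.symm '' L := by
    rw [e.symm_image_eq_source_inter_preimage hLt.2]
  have hKc : IsCompact (e.symm '' L) := hLt.1.image_of_continuousOn (e.continuousOn_symm.mono hLt.2)
  rw [hK]
  refine (g.volumeMeasure_le_chartMeasure p hKc.isClosed.measurableSet
    (by rw [← hK]; exact inter_subset_left)).trans_lt ?_
  rw [chartMeasure_apply g p hKc.isClosed.measurableSet]
  have hsub : e.target ∩ e.symm ⁻¹' (e.symm '' L) ⊆ L := by
    rintro u ⟨hu, w, hw, h⟩
    rwa [← e.symm.injOn (hLt.2 hw) hu h]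
  refine (lintegral_mono_set hsub).trans_lt ?_
  obtain ⟨C, hC⟩ := hLt.1.bddAbove_image ((g.contDiffOn_density p).continuousOn.mono hLt.2)
  calc ∫⁻ u in L, ENNReal.ofReal (g.density p u) ≤ ∫⁻ u in L, ENNReal.ofReal C :=
        setLIntegral_mono measurable_const fun u hu =>
          ENNReal.ofReal_le_ofReal (hC (mem_image_of_mem _ hu))
    _ < ⊤ := by
        rw [setLIntegral_const]
        exact ENNReal.mul_lt_top ENNReal.ofReal_lt_top hLt.1.measure_lt_top

/-- The volume dominates each chart measure, and the density is strictly positive on a chart target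
because the metric is nondegenerate. -/
instance isOpenPosMeasure_volumeMeasure (g : LorentzianMetric d M) :
    g.volumeMeasure.IsOpenPosMeasure := by
  refine ⟨fun U hU ⟨p, hp⟩ h0 => ?_⟩
  set e := chartAt (Coord d) p with he
  have h1 : g.chartMeasure p U = 0 :=
    le_antisymm (h0 ▸ (le_iSup g.chartMeasure p : g.chartMeasure p ≤ g.volumeMeasure) U) bot_le
  rw [chartMeasure_apply g p hU.measurableSet] at h1
  have hV : IsOpen (e.target ∩ e.symm ⁻¹' U) := e.symm.isOpen_inter_preimage hU
  have hVn : (e.target ∩ e.symm ⁻¹' U).Nonempty := by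
    refine ⟨e p, mem_chart_target _ p, ?_⟩
    simpa [e.left_inv (mem_chart_source (Coord d) p)] using hp
  have hmeas : AEMeasurable (fun u => ENNReal.ofReal (g.density p u))
      ((volume : Measure (Coord d)).restrict (e.target ∩ e.symm ⁻¹' U)) :=
    (((g.contDiffOn_density p).continuousOn.mono inter_subset_left).aemeasurable
      hV.measurableSet).ennreal_ofReal
  rw [lintegral_eq_zero_iff' hmeas] at h1
  have h2 : ∀ᵐ u ∂(volume : Measure (Coord d)).restrict (e.target ∩ e.symm ⁻¹' U), False := by
    filter_upwards [h1, ae_restrict_mem hV.measurableSet] with u hu hum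
    have := density_pos_of_det (g.det_metricCoord_ne_zero p hum.1)
    simp only [Pi.zero_apply, ENNReal.ofReal_eq_zero] at hu
    linarith
  have h3 : (volume : Measure (Coord d)) (e.target ∩ e.symm ⁻¹' U) = 0 := by
    simpa using h2
  exact (hV.measure_pos volume hVn).ne' h3

end LorentzianMetric

end VolumeMeasure

/-! ### Smooth functions with support in a fixed compact set form a barrelled space. -/

section SupportedFunctions

open scoped Distributions
open ContDiffMapSupportedIn TopologicalSpace

variable {E F : Type*} [NormedAddCommGroup E] [NormedSpace ℝ E] [NormedAddCommGroup F]
  [NormedSpace ℝ F] {K : Compacts E}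

/-- If the derivatives of every order converge uniformly, each limit is the derivative of the
preceding one, so a limit of jets is again the jet of a smooth function. This closedness in a
product of Banach spaces yields completeness. -/
theorem isClosed_range_structureMap :
    IsClosed (range (ContinuousLinearMap.pi (structureMapCLM ℝ (⊤ : ℕ∞)) :
      𝓓_{K}(E, F) →L[ℝ] Π i, BoundedContinuousFunction E (E [×i]→L[ℝ] F))) := by
  refine IsSeqClosed.isClosed fun u G hu hG => ?_
  choose h hh using hu
  have hval : ∀ i j x, u j i x = iteratedFDeriv ℝ i (h j) x := by
    intro i j x
    rw [← hh j, ← structureMapCLM_top_apply (𝕜 := ℝ)]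
    rfl
  have hunif : ∀ i, TendstoUniformly (fun j x => u j i x) (G i) atTop := fun i =>
    BoundedContinuousFunction.tendsto_iff_tendstoUniformly.1
      ((continuous_apply i).continuousAt.tendsto.comp hG)
  have hder : ∀ i x, HasFDerivAt (fun y => G i y) (G (i + 1) x).curryLeft x := by
    intro i x
    refine hasFDerivAt_of_tendstoUniformly (l := atTop) (f := fun j y => u j i y)
      (f' := fun j y => (u j (i + 1) y).curryLeft) (g' := fun y => (G (i + 1) y).curryLeft)
      ?_ ?_ (fun y => (hunif i).tendsto_at y) x
    · exact (continuousMultilinearCurryLeftEquiv ℝ (fun _ : Fin (i + 1) => E)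
        F).isometry.uniformContinuous.comp_tendstoUniformly (hunif (i + 1))
    · intro j y
      have h1 := (contDiff_iff_ftaylorSeries.1 (h j).contDiff).fderiv i
        (by exact_mod_cast ENat.natCast_lt_top i) y
      simp only [hval]
      exact h1
  set g : E → F := fun x => (G 0 x).curry0 with hg
  have hT : HasFTaylorSeriesUpTo ((⊤ : ℕ∞) : ℕ∞ω) g (fun x i => G i x) :=
    ⟨fun x => rfl, fun i _ x => hder i x, fun i _ => (G i).continuous⟩
  have hzero : EqOn g 0 Kᶜ := by
    intro x hx
    have h1 : Tendsto (fun j => (u j 0 x).curry0) atTop (𝓝 (g x)) :=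
      ((continuousMultilinearCurryFin0 ℝ E F).continuous.tendsto _).comp
        ((hunif 0).tendsto_at x)
    refine tendsto_nhds_unique h1 ?_
    refine tendsto_const_nhds.congr fun j => ?_
    rw [hval]
    exact ((h j).zero_on_compl hx).symm
  refine ⟨⟨g, hT.contDiff, hzero⟩, ?_⟩
  funext i
  ext1 x
  have h1 := hT.eq_iteratedFDeriv (m := i) (by exact_mod_cast le_top) x
  change structureMapCLM ℝ (⊤ : ℕ∞) i _ x = G i x
  rw [structureMapCLM_top_apply, h1]
  rfl

/-- The space of smooth functions supported in a compact set is complete. -/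
instance completeSpace_supported [CompleteSpace F] : CompleteSpace 𝓓_{K}(E, F) := by
  have h := (isUniformEmbedding_pi_structureMapCLM (𝕜 := ℝ) (n := ⊤) (K := K) (E := E)
    (F := F)).isUniformInducing
  rw [completeSpace_iff_isComplete_range h]
  exact isClosed_range_structureMap.isComplete

/-- The uniformity is induced from a product of countably many metric spaces, one for each order of
differentiation. Besides Baire's theorem, this gives the sequential description of closed sets. -/
instance isCountablyGenerated_supported : (uniformity 𝓓_{K}(E, F)).IsCountablyGenerated := by
  have h := (isUniformEmbedding_pi_structureMapCLM (𝕜 := ℝ) (n := ⊤) (K := K) (E := E)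
    (F := F)).isUniformInducing
  rw [← h.comap_uniformity]
  infer_instance

/-- Completeness and a countably generated uniformity make the space Baire, and a Baire topological
vector space is barrelled. -/
instance barrelledSpace_supported : BarrelledSpace ℂ 𝓓_{K}(E, ℂ) :=
  haveI : BaireSpace 𝓓_{K}(E, ℂ) := inferInstance
  inferInstance

theorem tendsto_supported_iff {h : ℕ → 𝓓_{K}(E, F)} {h₀ : 𝓓_{K}(E, F)} :
    Tendsto h atTop (𝓝 h₀) ↔ ∀ i : ℕ, ∀ ε > 0, ∀ᶠ j in atTop, ∀ x ∈ K,
      ‖iteratedFDeriv ℝ i (h j - h₀) x‖ ≤ ε := by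
  rw [(ContDiffMapSupportedIn.withSeminorms ℝ E F ⊤ K).tendsto_nhds]
  refine forall_congr' fun i => ?_
  constructor
  · intro H ε hε
    filter_upwards [H ε hε] with j hj
    exact (ContDiffMapSupportedIn.seminorm_top_le_iff ℝ hε.le i _).1 hj.le
  · intro H ε hε
    -- Convergence in the seminorms asks for a strict inequality, hence the half.
    filter_upwards [H (ε / 2) (half_pos hε)] with j hj
    exact ((ContDiffMapSupportedIn.seminorm_top_le_iff ℝ (half_pos hε).le i _).2 hj).trans_lt
      (half_lt_self hε)

end SupportedFunctions

/-! ### Passage between test functions on the manifold and in charts; automatic continuity of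
seminorms. -/

section ChartExtension

open scoped Distributions
open TopologicalSpace

variable {d : ℕ} {M : Type*} [TopologicalSpace M] [T2Space M] [ChartedSpace (Coord d) M]
  [IsManifold 𝓘(ℝ, Coord d) ∞ M]

theorem isCompact_symm_image (p : M) {L : Set (Coord d)} (hL : IsCompact L)
    (hLp : L ⊆ (chartAt (Coord d) p).target) : IsCompact ((chartAt (Coord d) p).symm '' L) :=
  hL.image_of_continuousOn ((chartAt (Coord d) p).continuousOn_symm.mono hLp)

/-- The extension by zero of a function of the coordinates around `p`. -/
def chartExtend (p : M) (h : Coord d → ℂ) : M → ℂ :=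
  (chartAt (Coord d) p).source.indicator (h ∘ chartAt (Coord d) p)

theorem chartExtend_eq_zero (p : M) {h : Coord d → ℂ} {L : Set (Coord d)} (hh : EqOn h 0 Lᶜ)
    {x : M} (hx : x ∉ (chartAt (Coord d) p).symm '' L) : chartExtend p h x = 0 := by
  by_cases hs : x ∈ (chartAt (Coord d) p).source
  · rw [chartExtend, indicator_of_mem hs]
    refine hh fun h' => hx ⟨_, h', (chartAt (Coord d) p).left_inv hs⟩
  · rw [chartExtend, indicator_of_notMem hs]

/-- The source of the chart and the complement of the compact image of L form an open cover; the
extension is a composition of smooth maps on the first set and zero on the second. -/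
theorem contMDiff_chartExtend (p : M) {h : Coord d → ℂ} (hsm : ContDiff ℝ ∞ h)
    {L : Set (Coord d)} (hL : IsCompact L) (hLp : L ⊆ (chartAt (Coord d) p).target)
    (hh : EqOn h 0 Lᶜ) : ContMDiff 𝓘(ℝ, Coord d) 𝓘(ℝ, ℂ) ∞ (chartExtend p h) := by
  intro x
  by_cases hs : x ∈ (chartAt (Coord d) p).source
  · have h1 : ContMDiffAt 𝓘(ℝ, Coord d) 𝓘(ℝ, ℂ) ∞ (h ∘ chartAt (Coord d) p) x :=
      hsm.contMDiff.contMDiffAt.comp x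
        ((contMDiffOn_chart (I := 𝓘(ℝ, Coord d)) (n := ∞) (x := p)).contMDiffAt
          ((chartAt (Coord d) p).open_source.mem_nhds hs))
    refine h1.congr_of_eventuallyEq ?_
    filter_upwards [(chartAt (Coord d) p).open_source.mem_nhds hs] with y hy
    exact indicator_of_mem hy _
  · have hx : x ∉ (chartAt (Coord d) p).symm '' L := by
      rintro ⟨u, hu, rfl⟩
      exact hs ((chartAt (Coord d) p).map_target (hLp hu))
    refine (contMDiffAt_const (c := (0 : ℂ))).congr_of_eventuallyEq ?_
    filter_upwards [(isCompact_symm_image p hL hLp).isClosed.isOpen_compl.mem_nhds hx] with y hy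
    exact chartExtend_eq_zero p hh hy

/-- The extension by zero of test functions of the coordinates around `p`. -/
def chartExtendTest (p : M) (L : Compacts (Coord d))
    (hLp : (L : Set (Coord d)) ⊆ (chartAt (Coord d) p).target) :
    𝓓_{L}(Coord d, ℂ) →ₗ[ℂ] TestFun d M where
  toFun h := ⟨chartExtend p h, contMDiff_chartExtend p h.contDiff L.isCompact hLp h.zero_on_compl,
    HasCompactSupport.intro (isCompact_symm_image p L.isCompact hLp)
      fun _ hx => chartExtend_eq_zero p h.zero_on_compl hx⟩
  map_add' h h' := by
    ext x
    exact congrFun (indicator_add (chartAt (Coord d) p).source (h ∘ chartAt (Coord d) p)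
      (h' ∘ chartAt (Coord d) p)) x
  map_smul' c h := by
    ext x
    exact congrFun (indicator_const_smul (chartAt (Coord d) p).source c
      (h ∘ chartAt (Coord d) p)) x

theorem tsupport_chartExtendTest_subset (p : M) (L : Compacts (Coord d))
    (hLp : (L : Set (Coord d)) ⊆ (chartAt (Coord d) p).target) (h : 𝓓_{L}(Coord d, ℂ)) :
    tsupport (chartExtendTest p L hLp h).1 ⊆ (chartAt (Coord d) p).symm '' L := by
  refine closure_minimal (fun x hx => ?_) (isCompact_symm_image p L.isCompact hLp).isClosed
  by_contra hx'
  exact hx (chartExtend_eq_zero p h.zero_on_compl hx')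

/-- The bound is taken at least 1 so that it is dominated by its own positive powers, the form in
which the estimate for derivatives of a composition needs it. -/
theorem exists_bound_iteratedFDerivWithin {E F : Type*} [NormedAddCommGroup E] [NormedSpace ℝ E]
    [NormedAddCommGroup F] [NormedSpace ℝ F] {f : E → F} {W K : Set E} (hW : IsOpen W)
    (hf : ContDiffOn ℝ ∞ f W) (hK : IsCompact K) (hKW : K ⊆ W) (k : ℕ) :
    ∃ D : ℝ, 1 ≤ D ∧ ∀ i ≤ k, ∀ u ∈ K, ‖iteratedFDerivWithin ℝ i f W u‖ ≤ D := by
  have h (i : ℕ) : ∃ C, ∀ u ∈ K, ‖iteratedFDerivWithin ℝ i f W u‖ ≤ C :=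
    hK.exists_bound_of_continuousOn ((hf.continuousOn_iteratedFDerivWithin
      (by exact_mod_cast le_top) hW.uniqueDiffOn).mono hKW)
  choose C hC using h
  refine ⟨1 + ∑ i ∈ Finset.range (k + 1), |C i|, ?_, fun i hi u hu => ?_⟩
  · linarith [Finset.sum_nonneg fun i (_ : i ∈ Finset.range (k + 1)) => abs_nonneg (C i)]
  · have h1 := Finset.single_le_sum (f := fun i => |C i|) (fun i _ => abs_nonneg _)
      (Finset.mem_range.2 (Nat.lt_succ_of_le hi))
    linarith [hC i u hu, le_abs_self (C i)]

/-- Extension by zero maps null sequences to null sequences. -/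
theorem nullSeqTest_chartExtendTest (p : M) (L : Compacts (Coord d))
    (hLp : (L : Set (Coord d)) ⊆ (chartAt (Coord d) p).target) (h : ℕ → 𝓓_{L}(Coord d, ℂ))
    (hh : ∀ i : ℕ, ∀ ε > 0, ∀ᶠ j in atTop, ∀ x ∈ L, ‖iteratedFDeriv ℝ i (h j) x‖ ≤ ε) :
    NullSeqTest fun j => chartExtendTest p L hLp (h j) := by
  refine ⟨⟨_, isCompact_symm_image p L.isCompact hLp,
    fun j => tsupport_chartExtendTest_subset p L hLp (h j)⟩, fun q k K hK hKq => ?_⟩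
  set e := chartAt (Coord d) p with he
  set e' := chartAt (Coord d) q with he'
  set L' : Set M := e.symm '' L with hL'
  have hL'c : IsClosed L' := (isCompact_symm_image p L.isCompact hLp).isClosed
  have hL's : L' ⊆ e.source := by
    rintro _ ⟨u, hu, rfl⟩
    exact e.map_target (hLp hu)
  -- Only the part of K that meets the carrier of the extended functions matters. It is compact and
  -- lies in the open set W where the coordinate change is smooth.
  set K' : Set (Coord d) := K ∩ e'.symm ⁻¹' L' with hK'
  have hK'c : IsCompact K' := hK.of_isClosed_subset
    ((e'.continuousOn_symm.mono hKq).preimage_isClosed_of_isClosed hK.isClosed hL'c)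
    inter_subset_left
  set W : Set (Coord d) := e'.target ∩ e'.symm ⁻¹' e.source with hW
  have hWo : IsOpen W := e'.symm.isOpen_inter_preimage e.open_source
  have hKW : K' ⊆ W := fun u hu => ⟨hKq hu.1, hL's hu.2⟩
  set τ : Coord d → Coord d := LorentzianMetric.transition (d := d) q p with hτ
  have hτs : ContDiffOn ℝ ∞ τ W := fun u hu =>
    (LorentzianMetric.transition_contDiffAt q p hu.1 hu.2).contDiffWithinAt
  obtain ⟨D, hD1, hD⟩ := exists_bound_iteratedFDerivWithin hWo hτs hK'c hKW k
  rw [Metric.tendstoUniformlyOn_iff]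
  intro ε hε
  -- The composition estimate gives the bound `k! * C * D ^ k`, and this choice of C makes it ε / 2.
  set C : ℝ := ε / (2 * (k.factorial * D ^ k)) with hC
  have hden : 0 < (k.factorial : ℝ) * D ^ k := by positivity
  have hCpos : 0 < C := by positivity
  have hev : ∀ᶠ j in atTop, ∀ i ∈ Finset.range (k + 1), ∀ x ∈ L,
      ‖iteratedFDeriv ℝ i (h j) x‖ ≤ C :=
    (Filter.eventually_all_finset _).2 fun i _ => hh i C hCpos
  filter_upwards [hev] with j hj u hu
  rw [Pi.zero_apply, dist_zero_left]
  by_cases huL : e'.symm u ∈ L'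
  · have huK : u ∈ K' := ⟨hu, huL⟩
    have hfun : EqOn ((chartExtendTest p L hLp (h j)).1 ∘ e'.symm) (h j ∘ τ) W := by
      intro w hw
      change chartExtend p (h j) (e'.symm w) = _
      rw [chartExtend, indicator_of_mem (show e'.symm w ∈ (chartAt (Coord d) p).source from hw.2)]
      rfl
    rw [← iteratedFDerivWithin_of_isOpen k hWo (hKW huK),
      iteratedFDerivWithin_congr hfun (hKW huK)]
    have hτL : τ u ∈ L := by
      obtain ⟨w, hw, hwu⟩ := huL
      have : τ u = w := by
        simp only [hτ, LorentzianMetric.transition, ← he, ← he']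
        rw [← hwu, e.right_inv (hLp hw)]
      rwa [this]
    have hb := norm_iteratedFDerivWithin_comp_le (n := k) (N := ∞) (g := h j) (t := univ)
      (h j).contDiff.contDiffOn
      hτs (by exact_mod_cast le_top) uniqueDiffOn_univ hWo.uniqueDiffOn (mapsTo_univ _ _)
      (hKW huK) (C := C) (D := D)
      (fun i hi => by
        rw [iteratedFDerivWithin_univ]
        exact hj i (Finset.mem_range.2 (Nat.lt_succ_of_le hi)) _ hτL)
      (fun i h1i hi => (hD i hi u huK).trans (le_self_pow₀ hD1 (by omega)))
    refine hb.trans_lt ?_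
    have : (k.factorial : ℝ) * C * D ^ k = ε / 2 := by
      rw [hC]
      field_simp
    rw [this]
    exact half_lt_self hε
  · have hz : ((chartExtendTest p L hLp (h j)).1 ∘ e'.symm) =ᶠ[𝓝 u] fun _ => (0 : ℂ) := by
      have hc := (e'.continuousAt_symm (hKq hu)).preimage_mem_nhds
        (hL'c.isOpen_compl.mem_nhds huL)
      filter_upwards [hc] with w hw
      exact chartExtend_eq_zero p (h j).zero_on_compl hw
    rw [(hz.iteratedFDeriv ℝ k).eq_of_nhds]
    rcases k with _ | k
    · simpa using hε
    · rw [iteratedFDeriv_const_of_ne (by omega)]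
      simpa using hε

/-- The product of a smooth function supported in the domain of the chart around `p` with a
test function supported in `K`, in the coordinates. -/
def localize (p : M) {χ : M → ℂ} (hχ : ContMDiff 𝓘(ℝ, Coord d) 𝓘(ℝ, ℂ) ∞ χ)
    (hχs : tsupport χ ⊆ (chartAt (Coord d) p).source) (L : Compacts (Coord d))
    (f : TestFun d M) (hf : chartAt (Coord d) p '' (tsupport χ ∩ tsupport f.1) ⊆ L) :
    𝓓_{L}(Coord d, ℂ) where
  toFun := (chartAt (Coord d) p).target.indicator
    ((fun x => χ x * f.1 x) ∘ (chartAt (Coord d) p).symm)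
  zero_on_compl' := by
    intro u hu
    by_cases ht : u ∈ (chartAt (Coord d) p).target
    · rw [indicator_of_mem ht]
      by_contra h0
      simp only [Function.comp_apply, Pi.zero_apply, mul_eq_zero, not_or] at h0
      exact hu (hf ⟨_, ⟨subset_tsupport _ h0.1, subset_tsupport _ h0.2⟩,
        (chartAt (Coord d) p).right_inv ht⟩)
    · rw [indicator_of_notMem ht]
      rfl
  contDiff' := by
    set e := chartAt (Coord d) p with he
    have hKc : IsCompact (tsupport χ ∩ tsupport f.1) := f.2.2.inter_left (isClosed_tsupport χ)
    have hKL : IsCompact (e '' (tsupport χ ∩ tsupport f.1)) :=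
      hKc.image_of_continuousOn (e.continuousOn.mono (inter_subset_left.trans hχs))
    rw [contDiff_iff_contDiffAt]
    intro u
    by_cases ht : u ∈ e.target
    · have h1 := (LorentzianMetric.contDiffOn_comp_symm (smooth_mul hχ f.2.1) p).contDiffAt
        (e.open_target.mem_nhds ht)
      refine h1.congr_of_eventuallyEq ?_
      filter_upwards [e.open_target.mem_nhds ht] with w hw
      exact indicator_of_mem hw _
    · have hu : u ∉ e '' (tsupport χ ∩ tsupport f.1) := by
        rintro ⟨x, hx, rfl⟩
        exact ht (e.map_source (hχs hx.1))
      refine (contDiffAt_const (c := (0 : ℂ))).congr_of_eventuallyEq ?_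
      filter_upwards [hKL.isClosed.isOpen_compl.mem_nhds hu] with w hw
      by_cases hwt : w ∈ e.target
      · rw [indicator_of_mem hwt]
        by_contra h0
        simp only [Function.comp_apply, mul_eq_zero, not_or] at h0
        exact hw ⟨_, ⟨subset_tsupport _ h0.1, subset_tsupport _ h0.2⟩, e.right_inv hwt⟩
      · rw [indicator_of_notMem hwt]

/-- Localizing and extending again is multiplication by χ, so a partition of unity recovers a test
function as a sum of extensions from charts. -/
theorem chartExtendTest_localize (p : M) {χ : M → ℂ}
    (hχ : ContMDiff 𝓘(ℝ, Coord d) 𝓘(ℝ, ℂ) ∞ χ)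
    (hχs : tsupport χ ⊆ (chartAt (Coord d) p).source) (L : Compacts (Coord d))
    (hLp : (L : Set (Coord d)) ⊆ (chartAt (Coord d) p).target)
    (f : TestFun d M) (hf : chartAt (Coord d) p '' (tsupport χ ∩ tsupport f.1) ⊆ L) (x : M) :
    (chartExtendTest p L hLp (localize p hχ hχs L f hf)).1 x = χ x * f.1 x := by
  change chartExtend p _ x = _
  by_cases hs : x ∈ (chartAt (Coord d) p).source
  · rw [chartExtend, indicator_of_mem hs]
    change (chartAt (Coord d) p).target.indicator _ (chartAt (Coord d) p x) = _
    rw [indicator_of_mem ((chartAt (Coord d) p).map_source hs)]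
    simp only [Function.comp_apply]
    rw [(chartAt (Coord d) p).left_inv hs]
  · rw [chartExtend, indicator_of_notMem hs, image_eq_zero_of_notMem_tsupport fun h => hs (hχs h),
      zero_mul]

theorem localize_tendsto (p : M) {χ : M → ℂ}
    (hχ : ContMDiff 𝓘(ℝ, Coord d) 𝓘(ℝ, ℂ) ∞ χ)
    (hχs : tsupport χ ⊆ (chartAt (Coord d) p).source) (L : Compacts (Coord d))
    (hLp : (L : Set (Coord d)) ⊆ (chartAt (Coord d) p).target)
    (f : ℕ → TestFun d M)
    (hf : ∀ j, chartAt (Coord d) p '' (tsupport χ ∩ tsupport (f j).1) ⊆ L)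
    (hnull : NullSeqTest f) (k : ℕ) (ε : ℝ) (hε : 0 < ε) :
    ∀ᶠ j in atTop, ∀ x ∈ L,
      ‖iteratedFDeriv ℝ k (localize p hχ hχs L (f j) (hf j)) x‖ ≤ ε := by
  set e := chartAt (Coord d) p with he
  have hχc := LorentzianMetric.contDiffOn_comp_symm hχ p
  obtain ⟨B, hB1, hB⟩ := exists_bound_iteratedFDerivWithin e.open_target hχc L.isCompact hLp k
  -- In the Leibniz rule the binomial coefficients sum to `2 ^ k`, and B bounds the derivatives of
  -- χ.
  set δ : ℝ := ε / (2 ^ k * B) with hδ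
  have hδpos : 0 < δ := by positivity
  have hev : ∀ᶠ j in atTop, ∀ i ∈ Finset.range (k + 1), ∀ u ∈ (L : Set (Coord d)),
      ‖iteratedFDeriv ℝ i ((f j).1 ∘ e.symm) u‖ < δ := by
    refine (Filter.eventually_all_finset _).2 fun i _ => ?_
    have h1 := hnull.2 p i L L.isCompact hLp
    rw [Metric.tendstoUniformlyOn_iff] at h1
    simpa using h1 δ hδpos
  filter_upwards [hev] with j hj u hu
  have hut := hLp hu
  have hfun : EqOn (localize p hχ hχs L (f j) (hf j))
      (fun w => (χ ∘ e.symm) w * ((f j).1 ∘ e.symm) w) e.target :=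
    fun w hw => indicator_of_mem hw _
  rw [← iteratedFDerivWithin_of_isOpen k e.open_target hut, iteratedFDerivWithin_congr hfun hut]
  refine (norm_iteratedFDerivWithin_mul_le hχc
    (LorentzianMetric.contDiffOn_comp_symm (f j).2.1 p) e.open_target.uniqueDiffOn hut
    (n := k) (by exact_mod_cast le_top)).trans ?_
  calc ∑ i ∈ Finset.range (k + 1), (k.choose i : ℝ) *
        ‖iteratedFDerivWithin ℝ i (χ ∘ e.symm) e.target u‖ *
        ‖iteratedFDerivWithin ℝ (k - i) ((f j).1 ∘ e.symm) e.target u‖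
      ≤ ∑ i ∈ Finset.range (k + 1), (k.choose i : ℝ) * B * δ := by
        refine Finset.sum_le_sum fun i hi => ?_
        have hik := Nat.lt_succ_iff.1 (Finset.mem_range.1 hi)
        have h2 := (hj (k - i) (Finset.mem_range.2 (by omega)) u hu).le
        rw [iteratedFDerivWithin_of_isOpen (k - i) e.open_target hut]
        have h3 := hB i hik u hu
        gcongr
    _ = ε := by
        rw [← Finset.sum_mul, ← Finset.sum_mul]
        have : (∑ i ∈ Finset.range (k + 1), (k.choose i : ℝ)) = 2 ^ k := by
          exact_mod_cast Nat.sum_range_choose k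
        rw [this, hδ]
        field_simp

/-- A seminorm on the test functions that is lower semicontinuous along the convergent
sequences is continuous along them. -/
theorem seminorm_tendsto_zero [SigmaCompactSpace M] (ρ : Seminorm ℂ (TestFun d M))
    (hρ : ∀ (F : ℕ → TestFun d M) (f : TestFun d M) (c : ℝ), NullSeqTest (fun j => F j - f) →
      (∀ j, ρ (F j) ≤ c) → ρ f ≤ c)
    (F : ℕ → TestFun d M) (hF : NullSeqTest F) : Tendsto (fun j => ρ (F j)) atTop (𝓝 0) := by
  -- Pulled back to a chart, the seminorm has sequentially closed sublevel sets by `hρ`. These are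
  -- closed since the space is sequential, and barrelledness turns lower semicontinuity into
  -- continuity.
  have hchart : ∀ (p : M) (L : Compacts (Coord d))
      (hLp : (L : Set (Coord d)) ⊆ (chartAt (Coord d) p).target),
      Continuous (ρ.comp (chartExtendTest p L hLp)) := by
    intro p L hLp
    refine Seminorm.continuous_of_lowerSemicontinuous _ ?_
    rw [lowerSemicontinuous_iff_isClosed_preimage]
    intro c
    refine IsSeqClosed.isClosed fun h h₀ hc hh => ?_
    refine hρ (fun j => chartExtendTest p L hLp (h j)) _ c ?_ hc
    have h1 := nullSeqTest_chartExtendTest p L hLp (fun j => h j - h₀) (tendsto_supported_iff.1 hh)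
    simpa only [map_sub] using h1
  obtain ⟨⟨K, hK, hFK⟩, -⟩ := id hF
  obtain ⟨P, hP⟩ := SmoothPartitionOfUnity.exists_isSubordinate_chartAt_source 𝓘(ℝ, Coord d) M
  -- By local finiteness only finitely many members of the partition of unity meet the common
  -- compact set K, so the decomposition of all `F j` uses one finite index set.
  have hfin : {i | (Function.support (P i) ∩ K).Nonempty}.Finite :=
    P.locallyFinite.finite_nonempty_inter_compact hK
  set t := hfin.toFinset with ht
  set χ : M → M → ℂ := fun i x => ((P i x : ℝ) : ℂ) with hχdef
  have hχ : ∀ i, ContMDiff 𝓘(ℝ, Coord d) 𝓘(ℝ, ℂ) ∞ (χ i) := fun i =>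
    Complex.ofRealCLM.contDiff.contMDiff.comp (P i).contMDiff
  have hχs : ∀ i, tsupport (χ i) ⊆ (chartAt (Coord d) i).source := fun i =>
    (closure_mono fun x hx => by simpa [hχdef] using hx).trans (hP i)
  have hLc : ∀ i, IsCompact (chartAt (Coord d) i '' (tsupport (χ i) ∩ K)) := fun i =>
    (hK.inter_left (isClosed_tsupport _)).image_of_continuousOn
      ((chartAt (Coord d) i).continuousOn.mono (inter_subset_left.trans (hχs i)))
  set L : M → Compacts (Coord d) := fun i => ⟨_, hLc i⟩ with hL
  have hLp : ∀ i, (L i : Set (Coord d)) ⊆ (chartAt (Coord d) i).target := by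
    rintro i _ ⟨x, hx, rfl⟩
    exact (chartAt (Coord d) i).map_source (hχs i hx.1)
  have hf : ∀ i j, chartAt (Coord d) i '' (tsupport (χ i) ∩ tsupport (F j).1) ⊆ L i :=
    fun i j => image_mono (inter_subset_inter_right _ (hFK j))
  have hdecomp : ∀ j, F j = ∑ i ∈ t, chartExtendTest i (L i) (hLp i)
      (localize i (hχ i) (hχs i) (L i) (F j) (hf i j)) := by
    intro j
    ext x
    rw [Submodule.coe_sum, Finset.sum_apply]
    have h1 : ∀ i, (chartExtendTest i (L i) (hLp i)
        (localize i (hχ i) (hχs i) (L i) (F j) (hf i j))).1 x = χ i x * (F j).1 x := fun i =>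
      chartExtendTest_localize i (hχ i) (hχs i) (L i) (hLp i) (F j) (hf i j) x
    simp only [h1]
    rw [← Finset.sum_mul]
    by_cases hx : x ∈ K
    · have hsum : ∑ i ∈ t, P i x = 1 := by
        rw [← P.sum_eq_one (mem_univ x)]
        refine (finsum_eq_sum_of_support_subset _ fun i hi => ?_).symm
        rw [ht, Finite.coe_toFinset]
        exact ⟨x, hi, hx⟩
      have hsum' : ∑ i ∈ t, χ i x = 1 := by
        simp only [hχdef]
        rw [← Complex.ofReal_sum, hsum, Complex.ofReal_one]
      rw [hsum', one_mul]
    · have h0 : (F j).1 x = 0 := image_eq_zero_of_notMem_tsupport fun h => hx (hFK j h)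
      rw [h0, mul_zero]
  have hterm : ∀ i ∈ t, Tendsto (fun j => ρ (chartExtendTest i (L i) (hLp i)
      (localize i (hχ i) (hχs i) (L i) (F j) (hf i j)))) atTop (𝓝 0) := by
    intro i _
    have h1 : Tendsto (fun j => localize i (hχ i) (hχs i) (L i) (F j) (hf i j)) atTop (𝓝 0) := by
      refine tendsto_supported_iff.2 fun k ε hε => ?_
      simpa only [sub_zero] using
        localize_tendsto i (hχ i) (hχs i) (L i) (hLp i) F (hf i) hF k ε hε
    have h2 := ((hchart i (L i) (hLp i)).tendsto 0).comp h1
    rw [map_zero] at h2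
    exact h2
  have hsumt := tendsto_finsetSum t hterm
  rw [Finset.sum_const_zero] at hsumt
  refine squeeze_zero (fun j => apply_nonneg ρ _) (fun j => ?_) hsumt
  calc ρ (F j) = ρ (∑ i ∈ t, chartExtendTest i (L i) (hLp i)
      (localize i (hχ i) (hχs i) (L i) (F j) (hf i j))) := by rw [← hdecomp j]
    _ ≤ _ := Finset.le_sum_of_subadditive ρ (map_zero ρ).le (map_add_le_add ρ) _ _

end ChartExtension

/-! ### Almost everywhere identities for the kernel functions and `L^n` bounds for the legs. -/

section Kernels

variable {d : ℕ} {M : Type*} [TopologicalSpace M] [T2Space M] [SecondCountableTopology M]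
  [ChartedSpace (Coord d) M] [IsManifold 𝓘(ℝ, Coord d) ∞ M] [MeasurableSpace M] [BorelSpace M]
  {S : Type*} [TopologicalSpace S] [ChartedSpace (EuclideanSpace ℝ (Fin d)) S]

theorem sigmaCompactSpace_of_chartedSpace (d : ℕ) (M : Type*) [TopologicalSpace M]
    [SecondCountableTopology M] [ChartedSpace (Coord d) M] : SigmaCompactSpace M :=
  have := ChartedSpace.locallyCompactSpace (Coord d) M
  inferInstance

theorem conjTest_conjTest (f : TestFun d M) : conjTest (conjTest f) = f := by
  ext x
  exact Complex.conj_conj _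

theorem integrable_mul_test {μ : Measure M} {u : M → ℂ} (hu : LocallyIntegrable u μ)
    (h : TestFun d M) : Integrable (fun y => u y * h.1 y) μ :=
  (hu.integrable_smul_right_of_hasCompactSupport h.2.1.continuous h.2.2)

/-- The fundamental lemma of the calculus of variations, for which real test functions suffice. It
converts the distributional identities for `D⁺` and `G_r` into a.e. identities that can be used
inside a vertex. -/
theorem ae_eq_zero_of_integral_mul_test {μ : Measure M} {u : M → ℂ}
    (hu : LocallyIntegrable u μ) (h : ∀ h : TestFun d M, ∫ y, u y * h.1 y ∂μ = 0) :
    u =ᵐ[μ] 0 := by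
  have := sigmaCompactSpace_of_chartedSpace d M
  refine ae_eq_zero_of_integral_contMDiff_smul_eq_zero 𝓘(ℝ, Coord d) hu fun g hg hgc => ?_
  have h1 := h ⟨fun x => ((g x : ℝ) : ℂ), Complex.ofRealCLM.contDiff.contMDiff.comp hg,
    hgc.comp_left Complex.ofReal_zero⟩
  rw [← h1]
  refine integral_congr_ae (ae_of_all _ fun x => ?_)
  simp [mul_comm]

theorem ae_eq_of_integral_mul_test {μ : Measure M} {u v : M → ℂ}
    (hu : LocallyIntegrable u μ) (hv : LocallyIntegrable v μ)
    (h : ∀ h : TestFun d M, ∫ y, u y * h.1 y ∂μ = ∫ y, v y * h.1 y ∂μ) : u =ᵐ[μ] v := by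
  have h1 : (fun y => u y - v y) =ᵐ[μ] 0 := by
    refine ae_eq_zero_of_integral_mul_test (d := d) (hu.sub hv) fun g => ?_
    have := integral_sub (integrable_mul_test hu g) (integrable_mul_test hv g)
    rw [h g, sub_self] at this
    rw [← this]
    refine integral_congr_ae (ae_of_all _ fun x => ?_)
    simp [sub_mul]
  filter_upwards [h1] with x hx
  exact sub_eq_zero.1 hx

/-- The kernels `D⁻(f, ·)`, which depend linearly on `f`. -/
def minusLinear (Dp : TestFun d M →ₗ[ℂ] (M → ℂ)) : TestFun d M →ₗ[ℂ] (M → ℂ) where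
  toFun := minusKernel Dp
  map_add' f h := by
    have : conjTest (f + h) = conjTest f + conjTest h := by
      ext x
      exact map_add (starRingEnd ℂ) _ _
    funext y
    simp [minusKernel, this]
  map_smul' c f := by
    have : conjTest (c • f) = (starRingEnd ℂ c) • conjTest f := by
      ext x
      exact map_mul (starRingEnd ℂ) _ _
    funext y
    simp [minusKernel, this]

/-- The kernels `G(f, ·)`, as a linear map into the functions. -/
def smoothLinear (G : TestFun d M →ₗ[ℂ] SmoothFun d M) : TestFun d M →ₗ[ℂ] (M → ℂ) :=
  (SmoothFun d M).subtype ∘ₗ G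

theorem smoothFun_continuous (u : SmoothFun d M) : Continuous u.1 := ContMDiff.continuous u.2

theorem smoothFun_locallyIntegrable (g : LorentzianMetric d M) (u : SmoothFun d M) :
    LocallyIntegrable u.1 g.volumeMeasure :=
  (smoothFun_continuous u).locallyIntegrable

namespace Spacetime

variable {X : Spacetime d M S} {m : ℝ} {Gr Ga : TestFun d M →ₗ[ℂ] SmoothFun d M}
  {Dp : TestFun d M →ₗ[ℂ] (M → ℂ)}

theorem IsFundamentalSolution.kleinGordon_ae {J : Set M → Set M}
    (hG : X.IsFundamentalSolution m J Gr) (f : TestFun d M) :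
    (Gr (kleinGordon X.metric m f)).1 =ᵐ[X.metric.volumeMeasure] f.1 :=
  ae_eq_of_integral_mul_test (d := d) (smoothFun_locallyIntegrable _ _)
    f.2.1.continuous.locallyIntegrable fun h => hG.left_inverse f h

theorem IsVacuumTwoPoint.kleinGordon_ae (hDp : X.IsVacuumTwoPoint m Gr Ga Dp)
    (f : TestFun d M) : Dp (kleinGordon X.metric m f) =ᵐ[X.metric.volumeMeasure] 0 :=
  ae_eq_zero_of_integral_mul_test (d := d) (hDp.locallyIntegrable _)
    fun h => hDp.kleinGordon_left f h

/-- Hermiticity moves the conjugated current into the second argument of `D⁺`, where the field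
equation applies. This avoids commuting the d'Alembertian with complex conjugation. -/
theorem IsVacuumTwoPoint.kleinGordon_minus_ae (hDp : X.IsVacuumTwoPoint m Gr Ga Dp)
    (f : TestFun d M) :
    minusKernel Dp (kleinGordon X.metric m f) =ᵐ[X.metric.volumeMeasure] 0 := by
  have h1 : Dp (conjTest (kleinGordon X.metric m f)) =ᵐ[X.metric.volumeMeasure] 0 := by
    refine ae_eq_zero_of_integral_mul_test (d := d) (hDp.locallyIntegrable _) fun h => ?_
    have h2 := hDp.hermitian (kleinGordon X.metric m f) (conjTest h)
    rw [hDp.kleinGordon_right, conjTest_conjTest] at h2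
    exact (map_eq_zero _).1 h2.symm
  filter_upwards [h1] with y hy
  simp [minusKernel, hy]

theorem IsVacuumTwoPoint.minus_locallyIntegrable (hDp : X.IsVacuumTwoPoint m Gr Ga Dp)
    (f : TestFun d M) : LocallyIntegrable (minusKernel Dp f) X.metric.volumeMeasure := by
  intro x
  obtain ⟨U, hU, hi⟩ := hDp.locallyIntegrable (conjTest f) x
  exact ⟨U, hU, (Complex.conjLIE.integrable_comp_iff).2 hi⟩

/-- The pointwise form of `Im D⁺ = G_r - G_a`. Where the advanced part vanishes, it bounds `G_r` by
the two-point kernels. -/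
theorem IsVacuumTwoPoint.sub_minus_ae (hDp : X.IsVacuumTwoPoint m Gr Ga Dp) (f : TestFun d M) :
    (fun y => Dp f y - minusKernel Dp f y) =ᵐ[X.metric.volumeMeasure]
      fun y => 2 * Complex.I * ((Gr f).1 y - (Ga f).1 y) := by
  set μ := X.metric.volumeMeasure with hμ
  refine ae_eq_of_integral_mul_test (d := d)
    ((hDp.locallyIntegrable f).sub (hDp.minus_locallyIntegrable f))
    (((smoothFun_locallyIntegrable X.metric (Gr f)).sub
      (smoothFun_locallyIntegrable X.metric (Ga f))).smul (2 * Complex.I)) fun h => ?_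
  have h1 := hDp.imaginary_part f h
  have h2 : starRingEnd ℂ (X.pairing Dp (conjTest f) (conjTest h))
      = ∫ y, minusKernel Dp f y * h.1 y ∂μ := by
    unfold pairing
    rw [← integral_conj]
    refine integral_congr_ae (ae_of_all _ fun y => ?_)
    simp [minusKernel, conjTest]
  rw [h2] at h1
  unfold pairing at h1
  rw [← integral_sub (integrable_mul_test (hDp.locallyIntegrable f) h)
    (integrable_mul_test (hDp.minus_locallyIntegrable f) h),
    ← integral_sub (integrable_mul_test (smoothFun_locallyIntegrable X.metric (Gr f)) h)
    (integrable_mul_test (smoothFun_locallyIntegrable X.metric (Ga f)) h),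
    ← integral_const_mul] at h1
  calc _ = _ := integral_congr_ae (ae_of_all _ fun y => by ring)
    _ = _ := h1
    _ = _ := integral_congr_ae (ae_of_all _ fun y => by
      beta_reduce; ring)

/-- The causally convex hull `J⁺(K) ∩ J⁻(K)`. -/
def hull (X : Spacetime d M S) (K : Set M) : Set M :=
  causalFuture X.metric X.time K ∩ causalPast X.metric X.time K

theorem isCompact_hull (X : Spacetime d M S) {K : Set M} (hK : IsCompact K) :
    IsCompact (X.hull K) := X.compact_hull K hK

/-- Outside the causally convex hull of the support, the retarded solution is controlled by the
two-point function. -/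
theorem IsVacuumTwoPoint.norm_retarded_le (hDp : X.IsVacuumTwoPoint m Gr Ga Dp)
    (hGr : X.IsRetarded m Gr) (hGa : X.IsAdvanced m Ga) {K : Set M} {f : TestFun d M}
    (hf : tsupport f.1 ⊆ K) {B : ℝ} (hB : ∀ y ∈ X.hull K, ‖(Gr f).1 y‖ ≤ B) :
    ∀ᵐ y ∂X.metric.volumeMeasure, ‖(Gr f).1 y‖ ≤
      ‖Dp f y‖ + ‖minusKernel Dp f y‖ + (X.hull K).indicator (fun _ => B) y := by
  filter_upwards [hDp.sub_minus_ae f] with y hy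
  by_cases hyC : y ∈ X.hull K
  · rw [indicator_of_mem hyC]
    linarith [hB y hyC, norm_nonneg (Dp f y), norm_nonneg (minusKernel Dp f y)]
  rw [indicator_of_notMem hyC, add_zero]
  -- Off the hull, a point of the past of K is not in its future, so `G_a f` vanishes and `2i G_r f
  -- = D⁺f - D⁻f`. Off the past, `G_r f` itself vanishes.
  by_cases hp : y ∈ causalPast X.metric X.time K
  · have hya : y ∉ tsupport (Ga f).1 := fun h => hyC ⟨by
      obtain ⟨x, hx, hxy⟩ := hGa.support f h
      exact ⟨x, hf hx, hxy⟩, hp⟩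
    rw [image_eq_zero_of_notMem_tsupport hya, sub_zero] at hy
    have h1 := norm_sub_le (Dp f y) (minusKernel Dp f y)
    rw [hy, norm_mul, norm_mul, Complex.norm_I, Complex.norm_ofNat, mul_one] at h1
    linarith [norm_nonneg ((Gr f).1 y)]
  · have hyr : y ∉ tsupport (Gr f).1 := fun h => hp (by
      obtain ⟨x, hx, hxy⟩ := hGr.support f h
      exact ⟨x, hf hx, hxy⟩)
    rw [image_eq_zero_of_notMem_tsupport hyr, norm_zero]
    positivity

/-- Minkowski's inequality for the pointwise bound. The hull is that of K and not of the support of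
f, so a single volume factor serves a whole null sequence supported in K. -/
theorem IsVacuumTwoPoint.eLpNorm_retarded_le (hDp : X.IsVacuumTwoPoint m Gr Ga Dp)
    (hGr : X.IsRetarded m Gr) (hGa : X.IsAdvanced m Ga) {K : Set M} (hK : IsCompact K)
    {f : TestFun d M} (hf : tsupport f.1 ⊆ K) {B : ℝ}
    (hB : ∀ y ∈ X.hull K, ‖(Gr f).1 y‖ ≤ B) {q : ENNReal} (hq1 : 1 ≤ q) (hq : q ≠ ⊤) :
    eLpNorm (Gr f).1 q X.metric.volumeMeasure ≤
      eLpNorm (Dp f) q X.metric.volumeMeasure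
        + eLpNorm (minusKernel Dp f) q X.metric.volumeMeasure
        + ‖B‖ₑ * X.metric.volumeMeasure (X.hull K) ^ (1 / q.toReal) := by
  set μ := X.metric.volumeMeasure with hμ
  have hC : MeasurableSet (X.hull K) := (X.isCompact_hull hK).isClosed.measurableSet
  have h1 := hDp.measurable f
  have h2 : Measurable (minusKernel Dp f) :=
    Complex.continuous_conj.measurable.comp (hDp.measurable (conjTest f))
  calc eLpNorm (Gr f).1 q μ
      ≤ eLpNorm (((fun y => ‖Dp f y‖) + fun y => ‖minusKernel Dp f y‖)
          + (X.hull K).indicator fun _ => B) q μ :=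
        eLpNorm_mono_ae_real (hDp.norm_retarded_le hGr hGa hf hB)
    _ ≤ eLpNorm (fun y => ‖Dp f y‖) q μ + eLpNorm (fun y => ‖minusKernel Dp f y‖) q μ
          + eLpNorm ((X.hull K).indicator fun _ => B) q μ :=
        (eLpNorm_add_le (h1.norm.add h2.norm).aestronglyMeasurable
          ((measurable_const.indicator hC).aestronglyMeasurable) hq1).trans
          (by
            gcongr
            exact eLpNorm_add_le h1.norm.aestronglyMeasurable h2.norm.aestronglyMeasurable hq1)
    _ = _ := by
        rw [eLpNorm_norm, eLpNorm_norm, eLpNorm_indicator_const hC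
          (zero_lt_one.trans_le hq1).ne' hq]

theorem exists_bound_hull (X : Spacetime d M S) (u : SmoothFun d M) {K : Set M}
    (hK : IsCompact K) : ∃ B, ∀ y ∈ X.hull K, ‖u.1 y‖ ≤ B :=
  (X.isCompact_hull hK).exists_bound_of_continuousOn (smoothFun_continuous u).continuousOn

section Powers

variable {n : ℕ}

theorem IsVacuumTwoPoint.memLp (hDp : X.IsVacuumTwoPoint m Gr Ga Dp) (hn : n ≠ 0)
    (hd : X.Dispersion Dp n) (f : TestFun d M) : MemLp (Dp f) n X.metric.volumeMeasure := by
  rw [← integrable_norm_rpow_iff (hDp.measurable f).aestronglyMeasurable (by exact_mod_cast hn)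
    (ENNReal.natCast_ne_top n)]
  simpa using hd.integrable f

theorem eLpNorm_minusKernel (Dp : TestFun d M →ₗ[ℂ] (M → ℂ)) (f : TestFun d M) (q : ENNReal)
    (μ : Measure M) : eLpNorm (minusKernel Dp f) q μ = eLpNorm (Dp (conjTest f)) q μ :=
  eLpNorm_congr_norm_ae (ae_of_all _ fun _ => RCLike.norm_conj _)

theorem IsVacuumTwoPoint.memLp_minus (hDp : X.IsVacuumTwoPoint m Gr Ga Dp) (hn : n ≠ 0)
    (hd : X.Dispersion Dp n) (f : TestFun d M) :
    MemLp (minusKernel Dp f) n X.metric.volumeMeasure := by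
  refine ⟨(Complex.continuous_conj.measurable.comp
    (hDp.measurable (conjTest f))).aestronglyMeasurable, ?_⟩
  rw [eLpNorm_minusKernel]
  exact (hDp.memLp hn hd _).2

theorem IsVacuumTwoPoint.memLp_retarded (hDp : X.IsVacuumTwoPoint m Gr Ga Dp)
    (hGr : X.IsRetarded m Gr) (hGa : X.IsAdvanced m Ga) (hn : n ≠ 0)
    (hd : X.Dispersion Dp n) (f : TestFun d M) :
    MemLp (Gr f).1 n X.metric.volumeMeasure := by
  refine ⟨(smoothFun_continuous _).aestronglyMeasurable, ?_⟩
  obtain ⟨B, hB⟩ := X.exists_bound_hull (Gr f) f.2.2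
  refine (hDp.eLpNorm_retarded_le hGr hGa f.2.2 subset_rfl hB
    (by exact_mod_cast Nat.one_le_iff_ne_zero.2 hn) (ENNReal.natCast_ne_top n)).trans_lt ?_
  refine ENNReal.add_lt_top.2 ⟨ENNReal.add_lt_top.2 ⟨(hDp.memLp hn hd f).2,
    (hDp.memLp_minus hn hd f).2⟩, ENNReal.mul_lt_top enorm_lt_top ?_⟩
  exact ENNReal.rpow_lt_top_of_nonneg (by positivity)
    (X.isCompact_hull f.2.2).measure_lt_top.ne

end Powers

end Spacetime

end Kernels

/-! ### Multilinear forms bounded through Hölder's inequality. -/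

section Multilinear

variable {V α : Type*} [AddCommGroup V] [Module ℂ V] [MeasurableSpace α] {μ : Measure α} {n : ℕ}

/-- Hölder's inequality with n exponents `1 / n`, which add up to 1. -/
theorem integrable_prod_of_memLp (hn : n ≠ 0) {u : Fin n → α → ℂ} (hu : ∀ l, MemLp (u l) n μ) :
    Integrable (fun y => ∏ l, u l y) μ := by
  rw [← memLp_one_iff_integrable]
  have h := MemLp.prod' (s := Finset.univ) fun l _ => hu l
  have h1 : (∑ _l : Fin n, ((n : ENNReal))⁻¹)⁻¹ = 1 := by
    rw [Finset.sum_const, Finset.card_univ, Fintype.card_fin, nsmul_eq_mul,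
      ENNReal.mul_inv_cancel (by exact_mod_cast hn) (ENNReal.natCast_ne_top n), inv_one]
  rwa [h1] at h

/-- Hölder's inequality for `n` functions in `L^n`. -/
theorem norm_integral_prod_le (hn : n ≠ 0) {u : Fin n → α → ℂ} (hu : ∀ l, MemLp (u l) n μ) :
    ‖∫ y, ∏ l, u l y ∂μ‖ ≤ ∏ l, (eLpNorm (u l) n μ).toReal := by
  have hn' : (n : ℝ) ≠ 0 := by exact_mod_cast hn
  have h1 : ∫⁻ y, ‖∏ l, u l y‖ₑ ∂μ ≤ ∏ l, eLpNorm (u l) n μ := by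
    calc ∫⁻ y, ‖∏ l, u l y‖ₑ ∂μ
        = ∫⁻ y, ∏ l, (‖u l y‖ₑ ^ (n : ℝ)) ^ (1 / (n : ℝ)) ∂μ := by
          refine lintegral_congr fun y => ?_
          have h : ‖∏ l, u l y‖ₑ = ∏ l, ‖u l y‖ₑ := by
            simp only [enorm, nnnorm_prod, ENNReal.ofNNReal_finsetProd]
          rw [h]
          refine Finset.prod_congr rfl fun l _ => ?_
          rw [← ENNReal.rpow_mul, mul_one_div_cancel hn', ENNReal.rpow_one]
      _ ≤ ∏ l, (∫⁻ y, ‖u l y‖ₑ ^ (n : ℝ) ∂μ) ^ (1 / (n : ℝ)) := by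
          refine ENNReal.lintegral_prod_norm_pow_le _
            (fun l _ => ((hu l).1.enorm).pow_const _) ?_ fun l _ => by positivity
          simp [hn']
      _ = ∏ l, eLpNorm (u l) n μ := by
          refine Finset.prod_congr rfl fun l _ => ?_
          rw [eLpNorm_eq_lintegral_rpow_enorm_toReal (by exact_mod_cast hn)
            (ENNReal.natCast_ne_top n), ENNReal.toReal_natCast]
  have htop : ∏ l, eLpNorm (u l) n μ ≠ ⊤ := ENNReal.prod_ne_top fun l _ => (hu l).2.ne
  rw [← ENNReal.toReal_prod, ← toReal_enorm]
  exact ENNReal.toReal_mono htop ((enorm_integral_le_lintegral_enorm _).trans h1)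

/-- The multilinear form `∫ ∏ₗ Aₗ(fₗ, y) dy` of kernels with values in `L^n`. -/
def integralProd (μ : Measure α) (hn : n ≠ 0) (A : Fin n → V →ₗ[ℂ] (α → ℂ))
    (hA : ∀ l f, MemLp (A l f) n μ) : MultilinearMap ℂ (fun _ : Fin n => V) ℂ where
  toFun f := ∫ y, ∏ l, A l (f l) y ∂μ
  map_update_add' f i v w := by
    rw [← integral_add (integrable_prod_of_memLp hn fun l => hA l _)
      (integrable_prod_of_memLp hn fun l => hA l _)]
    refine integral_congr_ae (ae_of_all _ fun y => ?_)
    -- For fixed y the integrand is a product of linear functionals, hence multilinear; additivity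
    -- in one slot is read off before integrating.
    set Q := MultilinearMap.compLinearMap (MultilinearMap.mkPiAlgebra ℂ (Fin n) ℂ)
      fun l => (LinearMap.proj y : (α → ℂ) →ₗ[ℂ] ℂ) ∘ₗ A l with hQ
    have h : ∀ g, Q g = ∏ l, A l (g l) y := fun g => by
      simp [hQ, MultilinearMap.compLinearMap_apply, MultilinearMap.mkPiAlgebra_apply]
    have h1 := Q.map_update_add f i v w
    simp only [h] at h1
    exact h1
  map_update_smul' f i c v := by
    rw [smul_eq_mul, ← integral_const_mul]
    refine integral_congr_ae (ae_of_all _ fun y => ?_)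
    set Q := MultilinearMap.compLinearMap (MultilinearMap.mkPiAlgebra ℂ (Fin n) ℂ)
      fun l => (LinearMap.proj y : (α → ℂ) →ₗ[ℂ] ℂ) ∘ₗ A l with hQ
    have h : ∀ g, Q g = ∏ l, A l (g l) y := fun g => by
      simp [hQ, MultilinearMap.compLinearMap_apply, MultilinearMap.mkPiAlgebra_apply]
    have h1 := Q.map_update_smul f i c v
    simp only [h] at h1
    exact h1

/-- Each factor is given the seminormed structure defined by its own seminorm; the map is then
bounded multilinear with constant 1, hence continuous. -/
theorem tendsto_of_seminorm_bound {ι : Type*} [Fintype ι] {E : ι → Type*}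
    [∀ i, AddCommGroup (E i)] [∀ i, Module ℂ (E i)] (ρ : ∀ i, Seminorm ℂ (E i))
    (L : MultilinearMap ℂ E ℂ) (hL : ∀ f, ‖L f‖ ≤ ∏ i, ρ i (f i))
    (F : ℕ → ∀ i, E i) (f : ∀ i, E i)
    (hF : ∀ i, Tendsto (fun j => ρ i (F j i - f i)) atTop (𝓝 0)) :
    Tendsto (fun j => L (F j)) atTop (𝓝 (L f)) := by
  let : ∀ i, SeminormedAddCommGroup (E i) := fun i =>
    (ρ i).toAddGroupSeminorm.toSeminormedAddCommGroup
  let : ∀ i, NormedSpace ℂ (E i) := fun i => ⟨fun c v => (map_smul_eq_mul (ρ i) c v).le⟩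
  have hb : ∀ f, ‖L f‖ ≤ 1 * ∏ i, ‖f i‖ := fun f => by
    rw [one_mul]
    exact hL f
  have hc := (L.mkContinuous 1 hb).cont
  refine (hc.tendsto f).comp (tendsto_pi_nhds.2 fun i => ?_)
  rw [tendsto_iff_norm_sub_tendsto_zero]
  exact hF i

/-- The seminorm `f ↦ ‖A(f, ·)‖_{L^q}`. -/
def lpSeminorm (μ : Measure α) (q : ENNReal) [Fact (1 ≤ q)] (A : V →ₗ[ℂ] (α → ℂ))
    (hA : ∀ f, MemLp (A f) q μ) : Seminorm ℂ V :=
  (normSeminorm ℂ (Lp ℂ q μ)).comp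
    { toFun := fun f => (hA f).toLp
      map_add' := fun f h => by
        rw [← MemLp.toLp_add]
        exact MemLp.toLp_congr _ _ (by rw [map_add])
      map_smul' := fun c f => by
        rw [RingHom.id_apply, ← MemLp.toLp_const_smul]
        exact MemLp.toLp_congr _ _ (by rw [map_smul]) }

theorem lpSeminorm_apply (μ : Measure α) (q : ENNReal) [Fact (1 ≤ q)] (A : V →ₗ[ℂ] (α → ℂ))
    (hA : ∀ f, MemLp (A f) q μ) (f : V) :
    lpSeminorm μ q A hA f = (eLpNorm (A f) q μ).toReal :=
  Lp.norm_toLp _ (hA f)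

end Multilinear

/-! ### Elementary null sequences of test functions. -/

section NullSequences

variable {d : ℕ} {M : Type*} [TopologicalSpace M] [ChartedSpace (Coord d) M]

theorem nullSeqTest_zero : NullSeqTest fun _ : ℕ => (0 : TestFun d M) := by
  refine ⟨⟨∅, isCompact_empty, fun j => ?_⟩, fun p k K hK hKp => ?_⟩
  · change tsupport (0 : M → ℂ) ⊆ ∅
    simp
  · rw [Metric.tendstoUniformlyOn_iff]
    intro ε hε
    refine Eventually.of_forall fun j u _ => ?_
    have h : ((0 : TestFun d M).1 ∘ (chartAt (Coord d) p).symm) = 0 := rfl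
    rw [h, iteratedFDeriv_zero, Pi.zero_apply, dist_self]
    exact hε

/-- Conjugation is a real linear isometry, so it preserves the norms of all derivatives. This
transfers continuity from `D⁺` to `D⁻`. -/
theorem NullSeqTest.conj {F : ℕ → TestFun d M} (hF : NullSeqTest F) :
    NullSeqTest fun j => conjTest (F j) := by
  obtain ⟨⟨K, hK, hFK⟩, h⟩ := hF
  refine ⟨⟨K, hK, fun j => (closure_mono fun x hx => ?_).trans (hFK j)⟩, fun p k L hL hLp => ?_⟩
  · intro h0
    exact hx (by
      change starRingEnd ℂ ((F j).1 x) = 0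
      rw [h0, map_zero])
  · have h1 := h p k L hL hLp
    rw [Metric.tendstoUniformlyOn_iff] at h1 ⊢
    intro ε hε
    filter_upwards [h1 ε hε] with j hj u hu
    have h2 := hj u hu
    rw [Pi.zero_apply, dist_zero_left] at h2 ⊢
    have h3 : ((conjTest (F j)).1 ∘ (chartAt (Coord d) p).symm)
        = Complex.conjLIE ∘ ((F j).1 ∘ (chartAt (Coord d) p).symm) := rfl
    rwa [h3, LinearIsometryEquiv.norm_iteratedFDeriv_comp_left]

end NullSequences

/-! ### Cut-offs, and convergence of the legs in `L^n` along null sequences. -/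

section AutomaticContinuity

variable {d : ℕ} {M : Type*} [TopologicalSpace M] [T2Space M] [SecondCountableTopology M]
  [ChartedSpace (Coord d) M] [IsManifold 𝓘(ℝ, Coord d) ∞ M]

theorem exists_smooth_cutoff {K V : Set M} (hK : IsCompact K) (hV : IsOpen V) (hKV : K ⊆ V) :
    ∃ φ : M → ℝ, ContMDiff 𝓘(ℝ, Coord d) 𝓘(ℝ, ℝ) ∞ φ ∧ HasCompactSupport φ ∧
      (∀ x, 0 ≤ φ x ∧ φ x ≤ 1) ∧ Function.support φ ⊆ V ∧ ∀ x ∈ K, φ x = 1 := by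
  have := ChartedSpace.locallyCompactSpace (Coord d) M
  obtain ⟨U, hU, hKU, hUV, hUc⟩ := exists_open_between_and_isCompact_closure hK hV hKV
  obtain ⟨φ, hφ, hr, hs, h1⟩ := exists_contMDiff_support_eq_eq_one_iff (n := (⊤ : ℕ∞)) 𝓘(ℝ, Coord d) hU
    hK.isClosed hKU
  refine ⟨φ, hφ, ?_, fun x => hr (mem_range_self x), ?_, fun x hx => (h1 x).1 hx⟩
  · rw [HasCompactSupport, tsupport, hs]
    exact hUc
  · rw [hs]
    exact subset_closure.trans hUV

/-- A cut-off sequence exists. -/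
theorem exists_isCutoff : ∃ χ : ℕ → TestFun d M, IsCutoff χ := by
  have := sigmaCompactSpace_of_chartedSpace d M
  have := ChartedSpace.locallyCompactSpace (Coord d) M
  let E : CompactExhaustion M := CompactExhaustion.choice M
  choose φ hφ hφc hφ1 _ hφE using fun n : ℕ =>
    exists_smooth_cutoff (d := d) (E.isCompact n) isOpen_univ (subset_univ _)
  refine ⟨fun n => ⟨fun x => ((φ n x : ℝ) : ℂ),
    Complex.ofRealCLM.contDiff.contMDiff.comp (hφ n), (hφc n).comp_left Complex.ofReal_zero⟩,
    fun j x => ⟨φ j x, (hφ1 j x).1, (hφ1 j x).2, rfl⟩, fun K hK => ?_⟩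
  obtain ⟨N, hN⟩ := E.exists_superset_of_isCompact hK
  filter_upwards [eventually_ge_atTop N] with n hn x hx
  rw [hφE n x (E.subset hn (hN hx)), Complex.ofReal_one]

variable [MeasurableSpace M] [BorelSpace M]

/-- Uniform bounds on an open set pass to weak limits. -/
theorem norm_le_of_weak_limit {μ : Measure M} [IsLocallyFiniteMeasure μ] [μ.IsOpenPosMeasure]
    {v : ℕ → M → ℂ} {u : M → ℂ} (hu : Continuous u)
    (hlim : ∀ h : TestFun d M,
      Tendsto (fun j => ∫ y, v j y * h.1 y ∂μ) atTop (𝓝 (∫ y, u y * h.1 y ∂μ)))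
    {U : Set M} (hU : IsOpen U) {c : ℝ} (hc : ∀ j, ∀ y ∈ U, ‖v j y‖ ≤ c) :
    ∀ y ∈ U, ‖u y‖ ≤ c := by
  intro y₀ hy₀
  by_contra hlt
  rw [not_le] at hlt
  -- Multiplication by a rotates the phase so that `u y₀ * a` is real and equal to `‖a‖ ^ 2`.
  -- Positivity of w then says that the real part of `u * a` exceeds the bound available for every
  -- `v j` on U.
  set a : ℂ := starRingEnd ℂ (u y₀) with ha
  have hna : ‖a‖ = ‖u y₀‖ := RCLike.norm_conj _
  have hc0 : 0 ≤ c := (norm_nonneg _).trans (hc 0 y₀ hy₀)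
  have hapos : 0 < ‖a‖ := by linarith
  set w : M → ℝ := fun z => (u z * a).re - c * ‖a‖ with hw
  have hwc : Continuous w :=
    (Complex.continuous_re.comp (hu.mul continuous_const)).sub continuous_const
  have hw0 : 0 < w y₀ := by
    have : (u y₀ * a).re = ‖a‖ * ‖a‖ := by
      rw [ha, Complex.mul_conj, Complex.ofReal_re, Complex.normSq_eq_norm_sq, ← ha, hna, sq]
    simp only [hw, this]
    rw [← sub_mul]
    exact mul_pos (by linarith) hapos
  obtain ⟨φ, hφ, hφc, hφ1, hφV, hφy⟩ := exists_smooth_cutoff (d := d) (isCompact_singleton (x := y₀))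
    (hU.inter (isOpen_lt continuous_const hwc)) (singleton_subset_iff.2 ⟨hy₀, hw0⟩)
  set h : TestFun d M := ⟨fun x => ((φ x : ℝ) : ℂ) * a,
    smooth_mul (Complex.ofRealCLM.contDiff.contMDiff.comp hφ) contMDiff_const,
    (hφc.comp_left Complex.ofReal_zero).mul_right⟩ with hh
  have hφi : Integrable φ μ := hφ.continuous.integrable_of_hasCompactSupport hφc
  have hui : ∀ {v : M → ℂ}, Continuous v → Integrable (fun y => v y * h.1 y) μ := fun hv =>
    integrable_mul_test hv.locallyIntegrable h
  have hbound : ∀ j, (∫ y, v j y * h.1 y ∂μ).re ≤ ∫ y, φ y * (c * ‖a‖) ∂μ := by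
    intro j
    refine (Complex.re_le_norm _).trans (norm_integral_le_of_norm_le (hφi.mul_const _)
      (ae_of_all _ fun y => ?_))
    change ‖v j y * (((φ y : ℝ) : ℂ) * a)‖ ≤ _
    rw [norm_mul, norm_mul, Complex.norm_real, Real.norm_of_nonneg (hφ1 y).1]
    by_cases hy : φ y = 0
    · simp [hy]
    · have h1 := hc j y (hφV hy).1
      have h2 := mul_le_mul_of_nonneg_right h1 (mul_nonneg (hφ1 y).1 (norm_nonneg a))
      linarith
  have hle : (∫ y, u y * h.1 y ∂μ).re ≤ ∫ y, φ y * (c * ‖a‖) ∂μ :=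
    le_of_tendsto ((Complex.continuous_re.tendsto _).comp (hlim h)) (Eventually.of_forall hbound)
  have hre : (∫ y, u y * h.1 y ∂μ).re = ∫ y, (u y * h.1 y).re ∂μ :=
    (integral_re (hui hu)).symm
  -- The bump function lives in the part of U where w is positive, so testing with `φ * a` gives the
  -- limit a strictly larger integral than the uniform bound allows.
  have hpos : 0 < ∫ y, φ y * w y ∂μ := by
    refine Continuous.integral_pos_of_hasCompactSupport_nonneg_nonzero (x := y₀)
      (hφ.continuous.mul hwc) hφc.mul_right (fun y => ?_) ?_
    · by_cases hy : φ y = 0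
      · simp [hy]
      · exact mul_nonneg (hφ1 y).1 (hφV hy).2.le
    · rw [hφy y₀ rfl, one_mul]
      exact hw0.ne'
  have heq : ∫ y, φ y * w y ∂μ = (∫ y, u y * h.1 y ∂μ).re - ∫ y, φ y * (c * ‖a‖) ∂μ := by
    have hsub := integral_sub (f := fun y => (u y * h.1 y).re) (hui hu).re
      (hφi.mul_const (c * ‖a‖))
    rw [hre, ← hsub]
    refine integral_congr_ae (ae_of_all _ fun y => ?_)
    change φ y * ((u y * a).re - c * ‖a‖)
      = (u y * (((φ y : ℝ) : ℂ) * a)).re - φ y * (c * ‖a‖)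
    have : u y * (((φ y : ℝ) : ℂ) * a) = ((φ y : ℝ) : ℂ) * (u y * a) := by ring
    rw [this, Complex.re_ofReal_mul]
    ring
  linarith

namespace Spacetime

variable {S : Type*} [TopologicalSpace S] [ChartedSpace (EuclideanSpace ℝ (Fin d)) S]
  {X : Spacetime d M S} {m : ℝ} {Gr Ga : TestFun d M →ₗ[ℂ] SmoothFun d M}
  {Dp : TestFun d M →ₗ[ℂ] (M → ℂ)}

theorem IsFundamentalSolution.tendsto_pairing {J : Set M → Set M}
    (hG : X.IsFundamentalSolution m J Gr) {F : ℕ → TestFun d M} {f : TestFun d M}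
    (hF : NullSeqTest fun j => F j - f) (h : TestFun d M) :
    Tendsto (fun j => ∫ y, (Gr (F j)).1 y * h.1 y ∂X.metric.volumeMeasure) atTop
      (𝓝 (∫ y, (Gr f).1 y * h.1 y ∂X.metric.volumeMeasure)) := by
  refine hG.distribution.continuous (fun j => ![F j, h]) ![f, h] fun l => ?_
  refine Fin.cases ?_ (fun i => ?_) l
  · exact hF
  · have : (fun j : ℕ => (![F j, h] : Fin 2 → TestFun d M) i.succ
        - (![f, h] : Fin 2 → TestFun d M) i.succ) = fun _ => 0 := by
      funext j
      simp
    rw [this]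
    exact nullSeqTest_zero

/-- The smooth kernel functions of a fundamental solution depend continuously on the test
function, in the topology of uniform convergence on compact sets. -/
theorem IsFundamentalSolution.tendsto_bound {J : Set M → Set M}
    (hG : X.IsFundamentalSolution m J Gr) {F : ℕ → TestFun d M} (hF : NullSeqTest F)
    {C : Set M} (hC : IsCompact C) :
    ∃ B : ℕ → ℝ, Tendsto B atTop (𝓝 0) ∧ ∀ j, ∀ y ∈ C, ‖(Gr (F j)).1 y‖ ≤ B j := by
  have := sigmaCompactSpace_of_chartedSpace d M
  have := ChartedSpace.locallyCompactSpace (Coord d) M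
  -- Weak limits preserve bounds on open sets only, so C is enlarged to an open U with compact
  -- closure and the supremum is taken over that closure.
  obtain ⟨U, hU, hCU, -, hUc⟩ :=
    exists_open_between_and_isCompact_closure hC isOpen_univ (subset_univ C)
  have : CompactSpace (closure U) := isCompact_iff_compactSpace.1 hUc
  let T : TestFun d M →ₗ[ℂ] C(closure U, ℂ) :=
    { toFun := fun f => ⟨fun y => (Gr f).1 y, (smoothFun_continuous _).comp continuous_subtype_val⟩
      map_add' := fun f h => by
        ext y
        simp
      map_smul' := fun c f => by
        ext y
        simp }
  let ρ : Seminorm ℂ (TestFun d M) := (normSeminorm ℂ C(closure U, ℂ)).comp T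
  have hle : ∀ f, ∀ y ∈ closure U, ‖(Gr f).1 y‖ ≤ ρ f := fun f y hy =>
    (T f).norm_coe_le_norm ⟨y, hy⟩
  refine ⟨fun j => ρ (F j), seminorm_tendsto_zero ρ (fun F f c hFf hc => ?_) F hF,
    fun j y hy => hle _ y (subset_closure (hCU hy))⟩
  -- Lower semicontinuity of the supremum: the bound passes to the weak limit on U and, by
  -- continuity, to the closure.
  refine ((T f).norm_le ((apply_nonneg ρ (F 0)).trans (hc 0))).2 fun y => ?_
  have h1 := norm_le_of_weak_limit (v := fun j => (Gr (F j)).1)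
    (smoothFun_continuous (Gr f)) (hG.tendsto_pairing hFf) hU
    (fun j y hy => (hle (F j) y (subset_closure hy)).trans (hc j))
  exact closure_minimal (t := {y | ‖(Gr f).1 y‖ ≤ c}) h1
    (isClosed_le (smoothFun_continuous _).norm continuous_const) y.2

section Powers

variable {n : ℕ}

/-- Pointwise convergence and Fatou's lemma make the `L^n` seminorm lower semicontinuous along
convergent sequences; automatic continuity then upgrades this to convergence of the norms to zero.
-/
theorem IsVacuumTwoPoint.tendsto_eLpNorm (hDp : X.IsVacuumTwoPoint m Gr Ga Dp) (hn : n ≠ 0)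
    (hd : X.Dispersion Dp n) {F : ℕ → TestFun d M} (hF : NullSeqTest F) :
    Tendsto (fun j => (eLpNorm (Dp (F j)) n X.metric.volumeMeasure).toReal) atTop (𝓝 0) := by
  have := sigmaCompactSpace_of_chartedSpace d M
  have : Fact (1 ≤ (n : ENNReal)) := ⟨by exact_mod_cast Nat.one_le_iff_ne_zero.2 hn⟩
  set μ := X.metric.volumeMeasure with hμ
  have hm := hDp.memLp hn hd
  have h := seminorm_tendsto_zero (lpSeminorm μ n Dp hm) (fun F f c hFf hc => ?_) F hF
  · simpa only [lpSeminorm_apply] using h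
  simp only [lpSeminorm_apply] at hc ⊢
  have hc0 : 0 ≤ c := ENNReal.toReal_nonneg.trans (hc 0)
  have hlim : ∀ x, Tendsto (fun j => Dp (F j) x) atTop (𝓝 (Dp f x)) := by
    intro x
    have h1 := (hd.pointwise _ hFf x).add_const (Dp f x)
    simpa using h1
  have h2 := Lp.eLpNorm_lim_le_liminf_eLpNorm (p := n) (μ := μ)
    (fun j => (hDp.measurable (F j)).aestronglyMeasurable) (Dp f) (ae_of_all _ hlim)
  refine ENNReal.toReal_le_of_le_ofReal hc0 (h2.trans ?_)
  refine liminf_le_of_le (by isBoundedDefault) fun b hb => ?_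
  obtain ⟨j, hj⟩ := hb.exists
  exact hj.trans ((ENNReal.le_ofReal_iff_toReal_le (hm (F j)).2.ne hc0).2 (hc j))

theorem IsVacuumTwoPoint.tendsto_eLpNorm_minus (hDp : X.IsVacuumTwoPoint m Gr Ga Dp) (hn : n ≠ 0)
    (hd : X.Dispersion Dp n) {F : ℕ → TestFun d M} (hF : NullSeqTest F) :
    Tendsto (fun j => (eLpNorm (minusKernel Dp (F j)) n X.metric.volumeMeasure).toReal) atTop
      (𝓝 0) := by
  simp only [eLpNorm_minusKernel]
  exact hDp.tendsto_eLpNorm hn hd hF.conj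

/-- Each term of `eLpNorm_retarded_le` tends to zero: the two-point terms by the preceding results,
the hull term because `G_r (F j)` tends to zero uniformly on the hull of the common support. -/
theorem IsVacuumTwoPoint.tendsto_eLpNorm_retarded (hDp : X.IsVacuumTwoPoint m Gr Ga Dp)
    (hGr : X.IsRetarded m Gr) (hGa : X.IsAdvanced m Ga) (hn : n ≠ 0)
    (hd : X.Dispersion Dp n) {F : ℕ → TestFun d M} (hF : NullSeqTest F) :
    Tendsto (fun j => (eLpNorm (Gr (F j)).1 n X.metric.volumeMeasure).toReal) atTop (𝓝 0) := by
  set μ := X.metric.volumeMeasure with hμ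
  obtain ⟨⟨K, hK, hFK⟩, -⟩ := id hF
  obtain ⟨B, hB0, hB⟩ := IsFundamentalSolution.tendsto_bound hGr hF (X.isCompact_hull hK)
  set V := μ (X.hull K) ^ (1 / (n : ENNReal).toReal) with hV
  have hVtop : V ≠ ⊤ := (ENNReal.rpow_lt_top_of_nonneg (by positivity)
    (X.isCompact_hull hK).measure_lt_top.ne).ne
  have hlim : Tendsto (fun j => (eLpNorm (Dp (F j)) n μ).toReal
      + (eLpNorm (minusKernel Dp (F j)) n μ).toReal + ‖B j‖ * V.toReal) atTop (𝓝 0) := by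
    have h1 := ((hDp.tendsto_eLpNorm hn hd hF).add (hDp.tendsto_eLpNorm_minus hn hd hF)).add
      (hB0.norm.mul_const V.toReal)
    simpa using h1
  refine squeeze_zero (fun j => ENNReal.toReal_nonneg) (fun j => ?_) hlim
  have h1 := hDp.eLpNorm_retarded_le hGr hGa hK (hFK j) (hB j)
    (q := n) (by exact_mod_cast Nat.one_le_iff_ne_zero.2 hn) (ENNReal.natCast_ne_top n)
  have hD := (hDp.memLp hn hd (F j)).2.ne
  have hM := (hDp.memLp_minus hn hd (F j)).2.ne
  have hBV : ‖B j‖ₑ * V ≠ ⊤ := ENNReal.mul_ne_top enorm_ne_top hVtop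
  have h2 := ENNReal.toReal_mono (ENNReal.add_ne_top.2 ⟨ENNReal.add_ne_top.2 ⟨hD, hM⟩, hBV⟩) h1
  rwa [ENNReal.toReal_add (ENNReal.add_ne_top.2 ⟨hD, hM⟩) hBV, ENNReal.toReal_add hD hM,
    ENNReal.toReal_mul, toReal_enorm] at h2

end Powers

end Spacetime

end AutomaticContinuity

/-! ### Vertex integrals converge absolutely and define distributions. -/

section Vertices

variable {d : ℕ} {M : Type*} [TopologicalSpace M] [T2Space M] [SecondCountableTopology M]
  [ChartedSpace (Coord d) M] [IsManifold 𝓘(ℝ, Coord d) ∞ M] [MeasurableSpace M] [BorelSpace M]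
  {S : Type*} [TopologicalSpace S] [ChartedSpace (EuclideanSpace ℝ (Fin d)) S]
  {X : Spacetime d M S} {m : ℝ} {Gr Ga : TestFun d M →ₗ[ℂ] SmoothFun d M}
  {Dp : TestFun d M →ₗ[ℂ] (M → ℂ)} {n : ℕ}

/-- The kernel of the `l`-th leg of the diagram whose `k`-th leg is retarded. -/
def legKernel (Gr : TestFun d M →ₗ[ℂ] SmoothFun d M) (Dp : TestFun d M →ₗ[ℂ] (M → ℂ))
    (k l : Fin n) : TestFun d M →ₗ[ℂ] (M → ℂ) :=
  if l < k then minusLinear Dp else if l = k then smoothLinear Gr else Dp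

/-- Writing the three kinds of factors as one product of linear kernels allows Hölder's inequality
to treat all legs alike. -/
theorem vertex_eq_prod (Gr : TestFun d M →ₗ[ℂ] SmoothFun d M)
    (Dp : TestFun d M →ₗ[ℂ] (M → ℂ)) (k : Fin n) (f : Fin n → TestFun d M) (y : M) :
    vertex Dp k (Gr (f k)).1 f y = ∏ l, legKernel Gr Dp k l (f l) y := by
  rw [← Finset.prod_mul_prod_compl (Finset.Iio k)]
  have hc : (Finset.Iio k)ᶜ = Finset.Ici k := by
    ext l
    simp
  rw [hc, ← Finset.mul_prod_Ioi_eq_prod_Ici, vertex, mul_assoc]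
  refine congrArg₂ _ (Finset.prod_congr rfl fun l hl => ?_) (congrArg₂ _ ?_
    (Finset.prod_congr rfl fun l hl => ?_))
  · rw [legKernel, if_pos (Finset.mem_Iio.1 hl)]
    rfl
  · rw [legKernel, if_neg (lt_irrefl k), if_pos rfl]
    rfl
  · have hkl := Finset.mem_Ioi.1 hl
    rw [legKernel, if_neg hkl.le.not_gt, if_neg hkl.ne']

theorem memLp_legKernel (hDp : X.IsVacuumTwoPoint m Gr Ga Dp)
    (hGr : X.IsRetarded m Gr) (hGa : X.IsAdvanced m Ga) (hn : n ≠ 0) (hd : X.Dispersion Dp n)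
    (k l : Fin n) (f : TestFun d M) :
    MemLp (legKernel Gr Dp k l f) n X.metric.volumeMeasure := by
  unfold legKernel
  split_ifs
  · exact hDp.memLp_minus hn hd f
  · exact hDp.memLp_retarded hGr hGa hn hd f
  · exact hDp.memLp hn hd f

theorem integrable_vertex (hDp : X.IsVacuumTwoPoint m Gr Ga Dp)
    (hGr : X.IsRetarded m Gr) (hGa : X.IsAdvanced m Ga) (hn : n ≠ 0) (hd : X.Dispersion Dp n)
    (k : Fin n) (f : Fin n → TestFun d M) :
    Integrable (vertex Dp k (Gr (f k)).1 f) X.metric.volumeMeasure := by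
  have h : vertex Dp k (Gr (f k)).1 f = fun y => ∏ l, legKernel Gr Dp k l (f l) y :=
    funext fun y => vertex_eq_prod Gr Dp k f y
  rw [h]
  exact integrable_prod_of_memLp hn fun l => memLp_legKernel hDp hGr hGa hn hd k l (f l)

/-- Hölder bounds the form by the product of the `L^n` seminorms of its legs, and each of these
tends to zero along null sequences. -/
theorem isDistribution_integral_vertex (hDp : X.IsVacuumTwoPoint m Gr Ga Dp)
    (hGr : X.IsRetarded m Gr) (hGa : X.IsAdvanced m Ga) (hn : n ≠ 0) (hd : X.Dispersion Dp n)
    (k : Fin n) :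
    IsDistribution fun f : Fin n → TestFun d M =>
      ∫ y, vertex Dp k (Gr (f k)).1 f y ∂X.metric.volumeMeasure := by
  have : Fact (1 ≤ (n : ENNReal)) := ⟨by exact_mod_cast Nat.one_le_iff_ne_zero.2 hn⟩
  set μ := X.metric.volumeMeasure with hμ
  have hm := memLp_legKernel hDp hGr hGa hn hd k
  set L := integralProd μ hn (legKernel Gr Dp k) hm with hL
  have hLf : ∀ f, L f = ∫ y, vertex Dp k (Gr (f k)).1 f y ∂μ := fun f =>
    integral_congr_ae (ae_of_all _ fun y => (vertex_eq_prod Gr Dp k f y).symm)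
  refine ⟨⟨L, hLf⟩, fun F f hF => ?_⟩
  simp only [← hLf]
  refine tendsto_of_seminorm_bound (fun l => lpSeminorm μ n (legKernel Gr Dp k l) (hm l)) L
    (fun f => ?_) F f fun l => ?_
  · simp only [lpSeminorm_apply]
    exact norm_integral_prod_le hn fun l => hm l (f l)
  · simp only [lpSeminorm_apply]
    unfold legKernel
    split_ifs
    · exact hDp.tendsto_eLpNorm_minus hn hd (hF l)
    · exact hDp.tendsto_eLpNorm_retarded hGr hGa hn hd (hF l)
    · exact hDp.tendsto_eLpNorm hn hd (hF l)

end Vertices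

/-! ### Induction on words in the letters incoming and local. -/

section Words

open FieldKind

/-- Every word arises from the all-local one by changing letters one at a time, which is the move
the Yang–Feldman condition relates. -/
theorem word_induction {n : ℕ} {P : (Fin n → FieldKind) → Prop} (h0 : P fun _ => loc)
    (hs : ∀ a k, a k = loc → P a → P (Function.update a k incoming)) (a : Fin n → FieldKind) :
    P a := by
  classical
  have h : ∀ s : Finset (Fin n), P fun i => if i ∈ s then incoming else loc := by
    intro s
    induction s using Finset.induction_on with
    | empty => simpa using h0
    | insert k s hk ih =>
      convert hs _ k (if_neg hk) ih using 1
      funext i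
      by_cases hi : i = k
      · subst hi
        simp
      · simp [hi]
  convert h (Finset.univ.filter fun i => a i = incoming) using 1
  funext i
  cases hi : a i <;> simp [hi]

theorem word_induction_reverse {n : ℕ} {P : (Fin n → FieldKind) → Prop}
    (h0 : P fun _ => incoming)
    (hs : ∀ a k, a k = loc → P (Function.update a k incoming) → P a) (a : Fin n → FieldKind) :
    P a := by
  classical
  have h : ∀ s : Finset (Fin n), P fun i => if i ∈ s then loc else incoming := by
    intro s
    induction s using Finset.induction_on with
    | empty => simpa using h0
    | insert k s hk ih =>
      refine hs _ k (if_pos (Finset.mem_insert_self k s)) ?_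
      convert ih using 1
      funext i
      by_cases hi : i = k
      · subst hi
        simp [hk]
      · simp [hi]
  convert h (Finset.univ.filter fun i => a i = loc) using 1
  funext i
  cases hi : a i <;> simp [hi]

end Words

/-! ### Linear combinations of distributions. -/

section Distributions

variable {d : ℕ} {M : Type*} [TopologicalSpace M] [ChartedSpace (Coord d) M] {n : ℕ}

theorem isDistribution_zero : IsDistribution fun _ : Fin n → TestFun d M => (0 : ℂ) :=
  ⟨⟨0, fun _ => rfl⟩, fun _ _ _ => tendsto_const_nhds⟩

theorem IsDistribution.const_mul {u : (Fin n → TestFun d M) → ℂ} (hu : IsDistribution u)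
    (c : ℂ) : IsDistribution fun f => c * u f := by
  obtain ⟨⟨L, hL⟩, hc⟩ := hu
  exact ⟨⟨c • L, fun f => by rw [← hL f]; rfl⟩, fun F f hF => (hc F f hF).const_mul c⟩

theorem IsDistribution.sum {ι : Type*} {s : Finset ι} {u : ι → (Fin n → TestFun d M) → ℂ}
    (hu : ∀ i ∈ s, IsDistribution (u i)) : IsDistribution fun f => ∑ i ∈ s, u i f := by
  classical
  refine ⟨?_, fun F f hF => tendsto_finsetSum s fun i hi => (hu i hi).continuous F f hF⟩
  induction s using Finset.induction_on with
  | empty => exact ⟨0, fun f => by simp⟩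
  | insert i s hi ih =>
    obtain ⟨L, hL⟩ := ih fun j hj => hu j (Finset.mem_insert_of_mem hj)
    obtain ⟨L', hL'⟩ := (hu i (Finset.mem_insert_self i s)).multilinear
    exact ⟨L' + L, fun f => by
      rw [_root_.add_apply, hL, hL', Finset.sum_insert hi]⟩

end Distributions

/-! ### Existence and uniqueness of the solution. -/

section Solution

variable {d : ℕ} {M : Type*} [TopologicalSpace M] [T2Space M] [SecondCountableTopology M]
  [ChartedSpace (Coord d) M] [IsManifold 𝓘(ℝ, Coord d) ∞ M] [MeasurableSpace M] [BorelSpace M]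
  {S : Type*} [TopologicalSpace S] [ChartedSpace (EuclideanSpace ℝ (Fin d)) S]
  {X : Spacetime d M S} {m b : ℝ} {bn : ℕ → ℝ} {Gr Ga : TestFun d M →ₗ[ℂ] SmoothFun d M}
  {Dp : TestFun d M →ₗ[ℂ] (M → ℂ)} {n : ℕ}

open FieldKind

theorem vertex_update_self (k : Fin n) (h : M → ℂ) (f : Fin n → TestFun d M) (g : TestFun d M) :
    vertex Dp k h (Function.update f k g) = vertex Dp k h f := by
  funext y
  unfold vertex
  congr 1
  · congr 1
    refine Finset.prod_congr rfl fun l hl => ?_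
    rw [Function.update_of_ne (Finset.mem_Iio.1 hl).ne]
  · refine Finset.prod_congr rfl fun l hl => ?_
    rw [Function.update_of_ne (Finset.mem_Ioi.1 hl).ne']

/-- A vertex with a current at one of its two-point legs vanishes. -/
theorem integral_vertex_eq_zero (hDp : X.IsVacuumTwoPoint m Gr Ga Dp) {k l : Fin n} (hkl : l ≠ k)
    (h : M → ℂ) {f : Fin n → TestFun d M} {g : TestFun d M}
    (hf : f l = kleinGordon X.metric m g) :
    ∫ y, vertex Dp k h f y ∂X.metric.volumeMeasure = 0 := by
  refine integral_eq_zero_of_ae ?_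
  rcases lt_or_gt_of_ne hkl with hlt | hlt
  · filter_upwards [hDp.kleinGordon_minus_ae g] with y hy
    unfold vertex
    rw [Finset.prod_eq_zero (Finset.mem_Iio.2 hlt) (by rw [hf]; exact hy), zero_mul, zero_mul]
    rfl
  · filter_upwards [hDp.kleinGordon_ae g] with y hy
    unfold vertex
    rw [Finset.prod_eq_zero (i := l) (Finset.mem_Ioi.2 hlt) (by rw [hf]; exact hy), mul_zero]
    rfl

theorem integral_vertex_kleinGordon (hGr : X.IsRetarded m Gr) (k : Fin n)
    (f : Fin n → TestFun d M) (g : TestFun d M) :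
    ∫ y, vertex Dp k (Gr (kleinGordon X.metric m g)).1 f y ∂X.metric.volumeMeasure
      = ∫ y, vertex Dp k g.1 f y ∂X.metric.volumeMeasure := by
  refine integral_congr_ae ?_
  filter_upwards [Spacetime.IsFundamentalSolution.kleinGordon_ae hGr g] with y hy
  unfold vertex
  rw [hy]

/-- The cut-off enters the vertex as a factor of modulus at most 1 that is eventually 1 at each
point, so the uncut integrand dominates. -/
theorem tendsto_integral_vertex_cutoff {μ : Measure M} {k : Fin n} {u : SmoothFun d M}
    {f : Fin n → TestFun d M} (hi : Integrable (vertex Dp k u.1 f) μ)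
    {χ : ℕ → TestFun d M} (hχ : IsCutoff χ) :
    Tendsto (fun N => ∫ y, vertex Dp k (mulSmooth (χ N) u).1 f y ∂μ) atTop
      (𝓝 (∫ y, vertex Dp k u.1 f y ∂μ)) := by
  have hv : ∀ N y, vertex Dp k (mulSmooth (χ N) u).1 f y = (χ N).1 y * vertex Dp k u.1 f y := by
    intro N y
    simp only [vertex, mulSmooth]
    ring
  simp only [hv]
  refine tendsto_integral_of_dominated_convergence (fun y => ‖vertex Dp k u.1 f y‖)
    (fun N => (χ N).2.1.continuous.aestronglyMeasurable.mul hi.1) hi.norm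
    (fun N => ae_of_all _ fun y => ?_) (ae_of_all _ fun y => ?_)
  · obtain ⟨r, h0, h1, hr⟩ := hχ.1 N y
    rw [norm_mul, hr, Complex.norm_real, Real.norm_of_nonneg h0]
    exact mul_le_of_le_one_left (norm_nonneg _) h1
  · refine tendsto_const_nhds.congr' ?_
    filter_upwards [hχ.2 {y} isCompact_singleton] with N hN
    rw [hN y rfl, one_mul]

/-- The indicator of the local field. -/
def localIndicator : FieldKind → ℂ
  | loc => 1
  | incoming => 0

/-- The truncated functions that solve the ansatz. -/
def truncatedSolution (X : Spacetime d M S) (m b : ℝ) (bn : ℕ → ℝ)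
    (Gr : TestFun d M →ₗ[ℂ] SmoothFun d M) (Dp : TestFun d M →ₗ[ℂ] (M → ℂ)) : Correlators d M
  | 0, _, _ => 0
  | 1, _, _ => 0
  | 2, _, f => (b ^ 2 / m ^ 2 : ℝ) * X.pairing Dp (f 0) (f 1)
  | n + 3, a, f => (bn (n + 3) : ℂ) * ∑ k, localIndicator (a k) *
      ∫ y, vertex Dp k (Gr (f k)).1 f y ∂X.metric.volumeMeasure

theorem truncatedSolution_of_three_le (hn : 3 ≤ n) (a : Fin n → FieldKind)
    (f : Fin n → TestFun d M) :
    truncatedSolution X m b bn Gr Dp n a f = (bn n : ℂ) * ∑ k, localIndicator (a k) *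
      ∫ y, vertex Dp k (Gr (f k)).1 f y ∂X.metric.volumeMeasure := by
  obtain ⟨n, rfl⟩ := Nat.exists_eq_add_of_le' hn
  rfl

/-- In every term with r ≠ k the current sits on a two-point leg and gives zero; in the k-th term
`G_r` undoes the Klein–Gordon operator. -/
theorem truncatedSolution_current (hGr : X.IsRetarded m Gr)
    (hDp : X.IsVacuumTwoPoint m Gr Ga Dp) (hn : 3 ≤ n) (a : Fin n → FieldKind)
    (f : Fin n → TestFun d M) (k : Fin n) (g : TestFun d M) :
    truncatedSolution X m b bn Gr Dp n a (Function.update f k (kleinGordon X.metric m g))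
      = (bn n : ℂ) * (localIndicator (a k) *
        ∫ y, vertex Dp k g.1 f y ∂X.metric.volumeMeasure) := by
  rw [truncatedSolution_of_three_le hn, Finset.sum_eq_single k]
  · rw [Function.update_self, integral_vertex_kleinGordon hGr, vertex_update_self]
  · intro r _ hr
    rw [integral_vertex_eq_zero hDp hr.symm _ (Function.update_self k _ f), mul_zero]
  · exact fun h => absurd (Finset.mem_univ k) h

theorem pairing_current (hDp : X.IsVacuumTwoPoint m Gr Ga Dp) {f : Fin 2 → TestFun d M}
    (k : Fin 2) {g : TestFun d M} (hf : f k = kleinGordon X.metric m g) :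
    X.pairing Dp (f 0) (f 1) = 0 := by
  fin_cases k
  · change f 0 = _ at hf
    rw [hf, hDp.kleinGordon_left]
  · change f 1 = _ at hf
    rw [hf, hDp.kleinGordon_right]

theorem isSolution_truncatedSolution (hGr : X.IsRetarded m Gr) (hGa : X.IsAdvanced m Ga)
    (hDp : X.IsVacuumTwoPoint m Gr Ga Dp)
    (hdisp : ∀ n, 3 ≤ n → bn n ≠ 0 → X.Dispersion Dp n) :
    IsSolution X m b bn Gr Dp (ofTruncated (truncatedSolution X m b bn Gr Dp))
      (truncatedSolution X m b bn Gr Dp) where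
  truncation := rfl
  one_point _ := rfl
  two_point _ := rfl
  one_current n hn k f := by
    rw [truncatedSolution_current hGr hDp hn, localIndicator, one_mul]
  two_currents n k r hkr f := by
    match n with
    | 0 => exact k.elim0
    | 1 => exact absurd (Subsingleton.elim k r) hkr
    | 2 =>
      change _ * X.pairing Dp _ _ = 0
      rw [pairing_current hDp r (Function.update_self r _ _), mul_zero]
    | n + 3 =>
      -- The current at r selects the r-th vertex, in which the current at k lies on a two-point
      -- leg.
      rw [truncatedSolution_current hGr hDp (by omega),
        integral_vertex_eq_zero hDp hkr _ (Function.update_self k _ f), mul_zero, mul_zero]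
  incoming_two_point _ := rfl
  incoming_quasi_free n hn f := by
    match n with
    | 0 => rfl
    | 1 => rfl
    | 2 => exact absurd rfl hn
    | n + 3 =>
      rw [truncatedSolution_of_three_le (by omega)]
      simp [localIndicator]
  yang_feldman n a k hk f χ hχ := by
    match n with
    | 0 => exact k.elim0
    | 1 =>
      change Tendsto (fun _ => (0 : ℂ)) atTop (𝓝 (0 - 0))
      rw [sub_zero]
      exact tendsto_const_nhds
    | 2 =>
      -- The two-point function does not depend on the word and `D⁺` vanishes on currents, so both
      -- sides are zero.
      refine tendsto_const_nhds.congr fun N => ?_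
      change _ - _ = _ * X.pairing Dp _ _
      rw [pairing_current hDp k (Function.update_self k _ f), mul_zero]
      exact sub_self _
    | n + 3 =>
      have hn : 3 ≤ n + 3 := by omega
      simp only [truncatedSolution_current hGr hDp hn, hk]
      rw [truncatedSolution_of_three_le hn, truncatedSolution_of_three_le hn]
      -- When `b_n = 0` the dispersion condition is not available, but every term carries this
      -- factor.
      by_cases hb : bn (n + 3) = 0
      · simp [hb]
      have hd := hdisp _ hn hb
      -- The two words differ only in letter k, so the difference of the sums is the k-th term.
      have hsub : ∀ I : Fin (n + 3) → ℂ, ∑ l, localIndicator (a l) * I l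
          - ∑ l, localIndicator (Function.update a k incoming l) * I l = I k := by
        intro I
        rw [← Finset.sum_sub_distrib, Finset.sum_eq_single k]
        · simp [hk, localIndicator]
        · intro l _ hl
          rw [Function.update_of_ne hl, sub_self]
        · exact fun h => absurd (Finset.mem_univ k) h
      rw [← mul_sub, hsub]
      simp only [localIndicator, one_mul]
      exact (tendsto_integral_vertex_cutoff (integrable_vertex hDp hGr hGa (by omega) hd k f)
        hχ).const_mul _

theorem isDistribution_truncatedSolution (hGr : X.IsRetarded m Gr) (hGa : X.IsAdvanced m Ga)
    (hDp : X.IsVacuumTwoPoint m Gr Ga Dp)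
    (hdisp : ∀ n, 3 ≤ n → bn n ≠ 0 → X.Dispersion Dp n) (n : ℕ) (a : Fin n → FieldKind) :
    IsDistribution (truncatedSolution X m b bn Gr Dp n a) := by
  match n with
  | 0 => exact isDistribution_zero
  | 1 => exact isDistribution_zero
  | 2 => exact hDp.distribution.const_mul _
  | n + 3 =>
    have hn : 3 ≤ n + 3 := by omega
    by_cases hb : bn (n + 3) = 0
    · convert isDistribution_zero (d := d) (M := M) (n := n + 3) using 1
      funext f
      rw [truncatedSolution_of_three_le hn, hb, Complex.ofReal_zero, zero_mul]
    · exact (IsDistribution.sum fun k _ => (isDistribution_integral_vertex hDp hGr hGa (by omega)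
        (hdisp _ hn hb) k).const_mul (localIndicator (a k))).const_mul _

namespace IsSolution

variable {W T W' T' : Correlators d M}

/-- If the replacement of a local field by its current vanishes, then the field may be replaced
by the incoming field. -/
theorem incoming_eq (hT : IsSolution X m b bn Gr Dp W T) {a : Fin n → FieldKind} {k : Fin n}
    (hk : a k = loc) {f : Fin n → TestFun d M}
    (h : ∀ g, T n a (Function.update f k (kleinGordon X.metric m g)) = 0) :
    T n (Function.update a k incoming) f = T n a f := by
  -- The Yang–Feldman condition quantifies over cut-off sequences, so one must exist for it to say
  -- anything.
  obtain ⟨χ, hχ⟩ := exists_isCutoff (d := d) (M := M)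
  have h1 := hT.yang_feldman n a k hk f χ hχ
  simp only [h] at h1
  exact (sub_eq_zero.1 (tendsto_nhds_unique h1 tendsto_const_nhds)).symm

/-- Induction on the incoming letters. To make letter s incoming, insert a current at s: the two
currents at k and r remain in place, so the function vanishes by the induction hypothesis and
`incoming_eq` applies. Stating the currents as equations for `f k` and `f r` makes them stable under
this update of slot s. -/
theorem two_currents_mixed (hT : IsSolution X m b bn Gr Dp W T) (a : Fin n → FieldKind) :
    ∀ (k r : Fin n), k ≠ r → a k = loc → a r = loc → ∀ (f : Fin n → TestFun d M)
      (g h : TestFun d M), f k = kleinGordon X.metric m g → f r = kleinGordon X.metric m h →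
        T n a f = 0 := by
  refine word_induction (P := fun a => ∀ (k r : Fin n), k ≠ r → a k = loc → a r = loc →
    ∀ (f : Fin n → TestFun d M) (g h : TestFun d M), f k = kleinGordon X.metric m g →
      f r = kleinGordon X.metric m h → T n a f = 0) ?_ ?_ a
  · intro k r hkr _ _ f g h hfk hfr
    have h1 := hT.two_currents n k r hkr (Function.update (Function.update f k g) r h)
    rw [Function.update_self, Function.update_of_ne hkr, Function.update_self] at h1
    convert h1 using 2
    funext l
    by_cases hlr : l = r
    · subst hlr
      rw [Function.update_self, hfr]
    · by_cases hlk : l = k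
      · subst hlk
        rw [Function.update_of_ne hlr, Function.update_self, hfk]
      · simp only [Function.update_of_ne hlr, Function.update_of_ne hlk]
  · intro a s hs ih k r hkr hk hr f g h hfk hfr
    have hks : k ≠ s := by
      rintro rfl
      simp at hk
    have hrs : r ≠ s := by
      rintro rfl
      simp at hr
    rw [Function.update_of_ne hks] at hk
    rw [Function.update_of_ne hrs] at hr
    rw [hT.incoming_eq hs, ih k r hkr hk hr f g h hfk hfr]
    intro g'
    exact ih k r hkr hk hr _ g h (by rw [Function.update_of_ne hks, hfk])
      (by rw [Function.update_of_ne hrs, hfr])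

/-- The truncated functions with one current are determined. -/
theorem one_current_eq (hT : IsSolution X m b bn Gr Dp W T)
    (hT' : IsSolution X m b bn Gr Dp W' T') (hn : 3 ≤ n) (a : Fin n → FieldKind) :
    ∀ k : Fin n, a k = loc → ∀ (f : Fin n → TestFun d M) (g : TestFun d M),
      f k = kleinGordon X.metric m g → T' n a f = T n a f := by
  refine word_induction (P := fun a => ∀ k : Fin n, a k = loc → ∀ (f : Fin n → TestFun d M)
    (g : TestFun d M), f k = kleinGordon X.metric m g → T' n a f = T n a f) ?_ ?_ a
  · intro k _ f g hf
    have h1 := hT.one_current n hn k (Function.update f k g)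
    have h2 := hT'.one_current n hn k (Function.update f k g)
    rw [← h1, Function.update_self, Function.update_idem, ← hf, Function.update_eq_self] at h2
    exact h2
  · intro a s hs ih k hk f g hf
    have hks : k ≠ s := by
      rintro rfl
      simp at hk
    rw [Function.update_of_ne hks] at hk
    have hf' : ∀ g', Function.update f s (kleinGordon X.metric m g') k
        = kleinGordon X.metric m g := fun g' => by rw [Function.update_of_ne hks, hf]
    -- A current inserted at s would be a second one besides that at k, so it gives zero and letter
    -- s may be made incoming in both solutions.
    rw [hT.incoming_eq hs fun g' => hT.two_currents_mixed a k s hks hk hs _ g g' (hf' g')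
        (Function.update_self s _ f),
      hT'.incoming_eq hs fun g' => hT'.two_currents_mixed a k s hks hk hs _ g g' (hf' g')
        (Function.update_self s _ f), ih k hk f g hf]

/-- Any current inserted into `D⁺` gives zero, so letters change from local to incoming without
changing the value. -/
theorem two_point_mixed (hDp : X.IsVacuumTwoPoint m Gr Ga Dp)
    (hT : IsSolution X m b bn Gr Dp W T) (a : Fin 2 → FieldKind) (f : Fin 2 → TestFun d M) :
    T 2 a f = (b ^ 2 / m ^ 2 : ℝ) * X.pairing Dp (f 0) (f 1) := by
  refine word_induction (P := fun a => ∀ f : Fin 2 → TestFun d M,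
    T 2 a f = (b ^ 2 / m ^ 2 : ℝ) * X.pairing Dp (f 0) (f 1)) hT.two_point ?_ a f
  intro a s hs ih f
  rw [hT.incoming_eq hs fun g => ?_, ih]
  rw [ih, pairing_current hDp s (Function.update_self s _ f), mul_zero]

/-- From three points on, both solutions agree on the all-incoming word. Yang–Feldman expresses the
change of a letter to local as a limit of one-current functions, on which they agree as well. The
empty word counts as all-incoming. -/
theorem truncated_unique (hDp : X.IsVacuumTwoPoint m Gr Ga Dp)
    (hT : IsSolution X m b bn Gr Dp W T) (hT' : IsSolution X m b bn Gr Dp W' T') : T' = T := by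
  funext n a f
  match n with
  | 0 =>
    rw [Subsingleton.elim a fun _ => incoming, hT.incoming_quasi_free 0 (by omega),
      hT'.incoming_quasi_free 0 (by omega)]
  | 1 =>
    have ha : a = fun _ => a 0 := funext fun i => congrArg a (Subsingleton.elim i 0)
    rw [ha]
    cases a 0
    · rw [hT.incoming_quasi_free 1 (by omega), hT'.incoming_quasi_free 1 (by omega)]
    · rw [hT.one_point, hT'.one_point]
  | 2 => rw [hT.two_point_mixed hDp, hT'.two_point_mixed hDp]
  | n + 3 =>
    have hn : 3 ≤ n + 3 := by omega
    obtain ⟨χ, hχ⟩ := exists_isCutoff (d := d) (M := M)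
    refine word_induction_reverse (P := fun a => ∀ f, T' (n + 3) a f = T (n + 3) a f)
      (fun f => ?_) (fun a k hk ih f => ?_) a f
    · rw [hT.incoming_quasi_free _ (by omega), hT'.incoming_quasi_free _ (by omega)]
    · have h1 := hT.yang_feldman (n + 3) a k hk f χ hχ
      have h2 := hT'.yang_feldman (n + 3) a k hk f χ hχ
      rw [ih f] at h2
      have h3 : ∀ N, T' (n + 3) a (Function.update f k (kleinGordon X.metric m
          (mulSmooth (χ N) (Gr (f k))))) = T (n + 3) a (Function.update f k
            (kleinGordon X.metric m (mulSmooth (χ N) (Gr (f k))))) := fun N =>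
        hT.one_current_eq hT' hn a k hk _ _ (Function.update_self k _ f)
      simp only [h3] at h2
      -- Both differences are limits of the same sequence and have the same subtrahend by the
      -- induction hypothesis.
      exact sub_left_injective (tendsto_nhds_unique h2 h1)

end IsSolution

end Solution

end CurvedQFT

end

open CurvedQFT in
theorem theorem3p1 (d : ℕ)
    (M : Type*) [TopologicalSpace M] [T2Space M] [SecondCountableTopology M]
    [ChartedSpace (Coord d) M] [IsManifold 𝓘(ℝ, Coord d) ∞ M]
    [MeasurableSpace M] [BorelSpace M]
    (S : Type*) [TopologicalSpace S] [ChartedSpace (EuclideanSpace ℝ (Fin d)) S]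
    [IsManifold 𝓘(ℝ, EuclideanSpace ℝ (Fin d)) ∞ S]
    (X : Spacetime d M S) (m b : ℝ) (hm : 0 < m) (hb : 0 < b) (bn : ℕ → ℝ)
    (Gr Ga : TestFun d M →ₗ[ℂ] SmoothFun d M)
    (hGr : X.IsRetarded m Gr) (hGa : X.IsAdvanced m Ga)
    (Dp : TestFun d M →ₗ[ℂ] (M → ℂ)) (hDp : X.IsVacuumTwoPoint m Gr Ga Dp)
    (hdisp : ∀ n, 3 ≤ n → bn n ≠ 0 → X.Dispersion Dp n) :
    ∃ W T : Correlators d M,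
      IsSolution X m b bn Gr Dp W T ∧
      (∀ W' T' : Correlators d M, IsSolution X m b bn Gr Dp W' T' → W' = W ∧ T' = T) ∧
      (∀ (a : Fin 2 → FieldKind) (f : Fin 2 → TestFun d M),
        T 2 a f = (b ^ 2 / m ^ 2 : ℝ) * X.pairing Dp (f 0) (f 1)) ∧
      (∀ n, 3 ≤ n → ∀ f : Fin n → TestFun d M,
        T n (fun _ => FieldKind.loc) f
          = (bn n : ℂ) * ∑ k, ∫ y, vertex Dp k (Gr (f k)).1 f y ∂X.metric.volumeMeasure) ∧
      (∀ n, 3 ≤ n → X.Dispersion Dp n → ∀ (k : Fin n) (f : Fin n → TestFun d M),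
        Integrable (vertex Dp k (Gr (f k)).1 f) X.metric.volumeMeasure) ∧
      (∀ (n : ℕ) (a : Fin n → FieldKind), IsDistribution (T n a)) := by
  refine ⟨ofTruncated (truncatedSolution X m b bn Gr Dp), truncatedSolution X m b bn Gr Dp,
    isSolution_truncatedSolution hGr hGa hDp hdisp, fun W' T' h' => ?_, fun a f => rfl,
    fun n hn f => ?_, fun n hn hd k f => integrable_vertex hDp hGr hGa (by omega) hd k f,
    isDistribution_truncatedSolution hGr hGa hDp hdisp⟩
  · have hT := IsSolution.truncated_unique hDp
      (isSolution_truncatedSolution hGr hGa hDp hdisp) h'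
    exact ⟨by rw [h'.truncation, hT], hT⟩
  · rw [truncatedSolution_of_three_le hn]
    simp only [localIndicator, one_mul]
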